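/- **Theorem.** Let $0\le k\le r$ and let $\lambda=(\lambda_1\ge\dots\ge\lambda_r\ge 0)$ be a partition of length at most $r$. *Notation.* Let $B_r=\mathbb Q[e_1,\dots,e_r]$, $E_r(z)=1-e_1z+\dots+(-1)^re_rz^r$, $\sum_{j\in\mathbb Z}h_jz^j=1/E_r(z)$ (so $h_j=0$ for $j<0$ and $h_0=1$), and $\Delta_\lambda(H_r)=\det(h_{\lambda_j-j+i})_{1\le i,j\le r}$. Let $V=\bigoplus_{i\ge0}\mathbb Q b_i$ with dual forms $\beta_j(b_i)=\delta_{ij}$, let $[\mathbf b]^r_\lambda=b_{r-1+\lambda_1}\wedge\dots\wedge b_{\lambda_r}$ and $[\boldsymbol\beta]^k_\nu=\beta_{k-1+\nu_1}\wedge\dots\wedge\beta_{\nu_k}$, and identify $\bigwedge^rV$ with $B_r$ through the linear isomorphism $[\mathbf b]^r_\lambda\mapsto\Delta_\lambda(H_r)$. For partitions $\mu,\nu$ of length at most $k$ let $[\mathbf b]^k_\mu\otimes[\boldsymbol\beta]^k_\nu$ act on $B_r\cong\bigwedge^rV$ by $u\mapsto[\mathbf b]^k_\mu\wedge([\boldsymbol\beta]^k_\nu\lrcorner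 u)$, where $\eta(\omega\lrcorner u)=(\omega\wedge\eta)(u)$ for the determinantal pairing. With formal variables $\mathbf z_k=(z_1,\dots,z_k)$, $\mathbf w_k=(w_1,\dots,w_k)$ and Schur polynomials $s_\mu$, put $$\mathcal E(\mathbf z_k,\mathbf w_k^{-1})=\sum_{\mu,\nu}s_\mu(\mathbf z_k)\,s_\nu(\mathbf w_k^{-1})\;[\mathbf b]^k_\mu\otimes[\boldsymbol\beta]^k_\nu .$$ Let $\overline\sigma_-(z):\bigwedge V\to\bigwedge V[z^{-1}]$ be the algebra homomorphism with $\overline\sigma_-(z)b_j=b_j-b_{j-1}z^{-1}$ ($b_{-1}=0$), regarded also as a map $B_r\to B_r[z^{-1}]$, and let $\overline\sigma_-(\mathbf z_k)=\overline\sigma_-(z_1)\cdots\overline\sigma_-(z_k)$. *Statement.* One has, in the fraction field of $B_r[\![\mathbf z_k,\mathbf w_k^{-1}]\!]$, $$\mathcal E(\mathbf z_k,\mathbf w_k^{-1})\Delta_\lambda(H_r)=\prod_{j=1}^k\left(\frac{z_j}{w_j}\right)^{r-k}\frac1{E_r(z_j)}\;\cdot\prod_{1\le i<j\le k}\frac1{1-w_i/w_j}\;\cdot\;\Delta_\lambda(\mathbf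 w_k^{-1},\overline\sigma_-(\mathbf z_k)H_r),$$ where $\Delta_\lambda(\mathbf w_k^{-1},\overline\sigma_-(\mathbf z_k)H_r)$ is the $r\times r$ determinant whose $(i,j)$ entry is $w_i^{-(\lambda_j-j+i)}$ for $1\le i\le k$ and $\overline\sigma_-(\mathbf z_k)h_{\lambda_j-j+i}$ for $k<i\le r$. Moreover, for all $j\in\mathbb Z$, $$\overline\sigma_-(\mathbf z_k)h_j=h_j-e_1(\mathbf z_k^{-1})h_{j-1}+\dots+(-1)^ke_k(\mathbf z_k^{-1})h_{j-k},$$ where $e_i(\mathbf z_k^{-1})$ is the $i$-th elementary symmetric polynomial in $z_1^{-1},\dots,z_k^{-1}$. -/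

import Mathlib

namespace BosonicRep

noncomputable section

/-- The polynomial ring `B_r = ℚ[e_1, …, e_r]`. -/
abbrev B (r : ℕ) : Type := MvPolynomial (Fin r) ℚ

/-- The generator `e_i` of `B_r`, with `e_0 = 1` and `e_i = 0` for `i > r`. -/
def e (r : ℕ) : ℕ → B r
  | 0 => 1
  | i + 1 => if hi : i < r then MvPolynomial.X ⟨i, hi⟩ else 0

/-- The generic polynomial `E_r(T) = 1 - e_1 T + ⋯ + (-1)^r e_r T^r`. -/
def E (r : ℕ) : Polynomial (B r) :=
  ∑ i ∈ Finset.range (r + 1), Polynomial.monomial i ((-1) ^ i * e r i)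

/-- The sequence `H_r = (h_j)_{j ∈ ℤ}`: `∑_j h_j T^j = 1 / E_r(T)`, and `h_j = 0` for `j < 0`. -/
def h (r : ℕ) (j : ℤ) : B r :=
  if 0 ≤ j then PowerSeries.coeff j.toNat (PowerSeries.invOfUnit (E r : PowerSeries (B r)) 1)
  else 0

/-- Partitions of length at most `r`, as weakly decreasing sequences `λ_1 ≥ ⋯ ≥ λ_r ≥ 0`
(the part `λ_{j+1}` is the value at `j : Fin r`). -/
def Part (r : ℕ) : Type := {l : Fin r → ℕ // Antitone l}

instance (r : ℕ) : CoeFun (Part r) (fun _ => Fin r → ℕ) := ⟨Subtype.val⟩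

/-- The determinant `det (h_{λ_j - j + i})_{1 ≤ i, j ≤ r}`. -/
def schurDet (r : ℕ) (l : Part r) : B r :=
  Matrix.det (Matrix.of fun i j : Fin r => h r ((l j : ℤ) - (j : ℕ) + (i : ℕ)))

/-- The vector space `V = ⨁_{i ≥ 0} ℚ b_i`. -/
abbrev V : Type := ℕ →₀ ℚ

/-- The basis vector `b_i` of `V`. -/
def b (i : ℕ) : V := Finsupp.single i 1

/-- `[b]^r_λ = b_{r-1+λ_1} ∧ b_{r-2+λ_2} ∧ ⋯ ∧ b_{λ_r}`. -/
def wedge (r : ℕ) (l : Part r) : ⋀[ℚ]^r V :=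
  exteriorPower.ιMulti ℚ r fun j => b (r - 1 - j + l j)

/-! ### The isomorphism `⋀^r V ≃ B_r` -/

/-- The `ℚ`-linear map `V → B_r^r`, `b_m ↦ (h_{m-r+1}, …, h_m)`. -/
def column (r : ℕ) : V →ₗ[ℚ] (Fin r → B r) :=
  Finsupp.linearCombination ℚ fun m i => h r ((m : ℤ) - r + 1 + (i : ℕ))

theorem column_b (r m : ℕ) (i : Fin r) : column r (b m) i = h r ((m : ℤ) - r + 1 + (i : ℕ)) := by
  simp [column, b]

/-- The alternating map `(v_1, …, v_r) ↦ det (column v_1, …, column v_r)`. -/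
def columnDet (r : ℕ) : V [⋀^Fin r]→ₗ[ℚ] B r where
  toMultilinearMap :=
    ((Matrix.detRowAlternating (n := Fin r) (R := B r)).toMultilinearMap.restrictScalars
      ℚ).compLinearMap fun _ => column r
  map_eq_zero_of_eq' v i j hij hne :=
    (Matrix.detRowAlternating (n := Fin r) (R := B r)).map_eq_zero_of_eq
      (fun j => column r (v j)) (by simp [hij]) hne

theorem columnDet_apply (r : ℕ) (v : Fin r → V) :
    columnDet r v = Matrix.det (Matrix.of fun j => column r (v j)) := rfl

/-- The `ℚ`-linear map `⋀^r V → B_r`, `[b]^r_λ ↦ Δ_λ(H_r)` (see `toBoson_wedge`). -/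
def toBoson (r : ℕ) : ⋀[ℚ]^r V →ₗ[ℚ] B r :=
  exteriorPower.alternatingMapLinearEquiv (columnDet r)

theorem toBoson_ιMulti (r : ℕ) (m : Fin r → ℕ) :
    toBoson r (exteriorPower.ιMulti ℚ r fun j => b (m j)) =
      Matrix.det (Matrix.of fun i j : Fin r => h r ((m j : ℤ) - r + 1 + (i : ℕ))) := by
  rw [toBoson, exteriorPower.alternatingMapLinearEquiv_apply_ιMulti, columnDet_apply,
    ← Matrix.det_transpose]
  congr 1
  ext i j : 2
  simp [column_b]

theorem toBoson_wedge (r : ℕ) (l : Part r) : toBoson r (wedge r l) = schurDet r l := by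
  rw [wedge, toBoson_ιMulti, schurDet]
  congr 2
  ext i j : 2
  congr 1
  have := j.2
  omega

/-- The homomorphism `B_r → ℚ[y_1, …, y_r]` sending `e_i` to the elementary symmetric polynomial. -/
def toSymm (r : ℕ) : B r →ₐ[ℚ] MvPolynomial (Fin r) ℚ :=
  MvPolynomial.aeval fun i => MvPolynomial.esymm (Fin r) ℚ (i + 1)

theorem toSymm_e (r i : ℕ) (hi : i ≤ r) : toSymm r (e r i) = MvPolynomial.esymm (Fin r) ℚ i := by
  cases i with
  | zero => simp [e]
  | succ i =>
    have : i < r := hi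
    simp [e, this, toSymm]

theorem map_E (r : ℕ) : (E r).map (toSymm r).toRingHom =
    ∏ i : Fin r, (1 - Polynomial.C (MvPolynomial.X i : MvPolynomial (Fin r) ℚ) * Polynomial.X) := by
  have h1 : ∀ i : Fin r, (1 - Polynomial.C (MvPolynomial.X i : MvPolynomial (Fin r) ℚ) *
      Polynomial.X) = 1 + -(Polynomial.C (MvPolynomial.X i : MvPolynomial (Fin r) ℚ) *
        Polynomial.X) :=
    fun i => sub_eq_add_neg _ _
  simp_rw [h1, Finset.prod_one_add, Finset.sum_powerset, E, Polynomial.map_sum,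
    Finset.card_univ, Fintype.card_fin]
  refine Finset.sum_congr rfl fun s hs => ?_
  rw [Polynomial.map_monomial]
  have hs' : s ≤ r := by simpa [Nat.lt_succ_iff] using hs
  have h2 : (toSymm r).toRingHom ((-1) ^ s * e r s) =
      (-1) ^ s * MvPolynomial.esymm (Fin r) ℚ s := by
    rw [← toSymm_e r s hs']
    simp
  rw [h2, MvPolynomial.esymm, Finset.mul_sum, map_sum]
  refine Finset.sum_congr rfl fun t ht => ?_
  have ht' : t.card = s := (Finset.mem_powersetCard.1 ht).2
  rw [← Polynomial.C_mul_X_pow_eq_monomial, map_mul, map_prod]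
  simp_rw [neg_eq_neg_one_mul (Polynomial.C (MvPolynomial.X _ : MvPolynomial (Fin r) ℚ) * _),
    Finset.prod_mul_distrib, Finset.prod_const, ht']
  simp [mul_assoc]

theorem E_mul_inv (r : ℕ) : (E r : PowerSeries (B r)) * PowerSeries.invOfUnit (E r) 1 = 1 := by
  apply PowerSeries.mul_invOfUnit
  rw [← PowerSeries.coeff_zero_eq_constantCoeff_apply, Polynomial.coeff_coe]
  simp [E, Polynomial.coeff_monomial, e]

/-- `∏_{j ≠ i} (1 - y_j T)`. -/
def cofactor (r : ℕ) (i : Fin r) : Polynomial (MvPolynomial (Fin r) ℚ) :=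
  ∏ j ∈ Finset.univ.erase i, (1 - Polynomial.C (MvPolynomial.X j) * Polynomial.X)

theorem cofactor_coeff (r : ℕ) (i : Fin r) (n : ℕ) (hn : r ≤ n) : (cofactor r i).coeff n = 0 := by
  apply Polynomial.coeff_eq_zero_of_natDegree_lt
  have h1 : (cofactor r i).natDegree ≤ ∑ j ∈ Finset.univ.erase i, 1 := by
    refine (Polynomial.natDegree_prod_le _ _).trans (Finset.sum_le_sum fun j _ => ?_)
    compute_degree
  have h2 : 0 < r := i.pos
  simp at h1
  omega

theorem pow_eq_sum (r : ℕ) (i : Fin r) (m : ℕ) :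
    (MvPolynomial.X i : MvPolynomial (Fin r) ℚ) ^ m =
      ∑ l : Fin r, (cofactor r i).coeff (r - 1 - l) *
        toSymm r (h r ((m : ℤ) - r + 1 + (l : ℕ))) := by
  set H : PowerSeries (MvPolynomial (Fin r) ℚ) :=
    PowerSeries.map (toSymm r).toRingHom (PowerSeries.invOfUnit (E r) 1) with hH
  have h1 : ((cofactor r i : Polynomial _) : PowerSeries (MvPolynomial (Fin r) ℚ)) *
      (1 - PowerSeries.C (MvPolynomial.X i) * PowerSeries.X) * H = 1 := by
    have := congrArg (PowerSeries.map (toSymm r).toRingHom) (E_mul_inv r)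
    rw [map_mul, map_one, ← Polynomial.polynomial_map_coe, map_E,
      ← Finset.prod_erase_mul _ _ (Finset.mem_univ i)] at this
    simpa [cofactor, hH] using this
  have h2 : ((cofactor r i : Polynomial _) : PowerSeries (MvPolynomial (Fin r) ℚ)) * H =
      PowerSeries.mk fun n => (MvPolynomial.X i) ^ n := by
    have h3 : (PowerSeries.mk fun n => (MvPolynomial.X i : MvPolynomial (Fin r) ℚ) ^ n) *
        (1 - PowerSeries.C (MvPolynomial.X i) * PowerSeries.X) = 1 := by
      ext n : 1
      cases n with
      | zero => simp [mul_sub, ← mul_assoc]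
      | succ n =>
        simp [mul_sub, ← mul_assoc, PowerSeries.coeff_succ_mul_X, PowerSeries.coeff_one, pow_succ]
    calc _ = (PowerSeries.mk fun n => (MvPolynomial.X i : MvPolynomial (Fin r) ℚ) ^ n) *
          (((cofactor r i : Polynomial _) : PowerSeries (MvPolynomial (Fin r) ℚ)) *
          (1 - PowerSeries.C (MvPolynomial.X i) * PowerSeries.X) * H) := by
            linear_combination (-(cofactor r i : PowerSeries (MvPolynomial (Fin r) ℚ)) * H) * h3
      _ = _ := by rw [h1, mul_one]
  have h4 := congrArg (PowerSeries.coeff m) h2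
  rw [PowerSeries.coeff_mk, PowerSeries.coeff_mul,
    Finset.Nat.sum_antidiagonal_eq_sum_range_succ_mk] at h4
  rw [← h4]
  have h5 : ∀ s : ℕ, toSymm r (h r ((m : ℤ) - s)) =
      if s ≤ m then PowerSeries.coeff (m - s) H else 0 := by
    intro s
    by_cases hs : s ≤ m
    · have : ((m : ℤ) - s).toNat = m - s := by omega
      rw [h, if_pos (by omega), if_pos hs, this, hH]
      simp
    · rw [h, if_neg (by omega), if_neg hs, map_zero]
  have h6 : ∑ l : Fin r, (cofactor r i).coeff (r - 1 - l) *
      toSymm r (h r ((m : ℤ) - r + 1 + (l : ℕ))) =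
      ∑ s ∈ Finset.range r, (cofactor r i).coeff s * toSymm r (h r ((m : ℤ) - s)) := by
    rw [← Finset.sum_range_reflect, Finset.sum_range]
    refine Finset.sum_congr rfl fun l _ => ?_
    have hl := l.2
    congr 3
    omega
  rw [h6]
  simp_rw [h5, Polynomial.coeff_coe]
  rw [Finset.sum_subset (s₁ := Finset.range r) (s₂ := Finset.range (m + 1 + r)),
    ← Finset.sum_subset (s₁ := Finset.range (m + 1)) (s₂ := Finset.range (m + 1 + r))]
  · refine Finset.sum_congr rfl fun s hs => ?_
    rw [if_pos (by simpa [Nat.lt_succ_iff] using hs)]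
  · simp
  · intro s _ hs
    rw [if_neg (by simpa [Nat.lt_succ_iff] using hs), mul_zero]
  · exact Finset.range_subset_range.2 (Nat.le_add_left r (m + 1))
  · intro s _ hs
    rw [cofactor_coeff r i s (by simpa using hs), zero_mul]

/-- The alternant `det (y_i ^ {m_j})`. -/
def alternant (r : ℕ) (m : Fin r → ℕ) : MvPolynomial (Fin r) ℚ :=
  Matrix.det (Matrix.of fun i j : Fin r => (MvPolynomial.X i : MvPolynomial (Fin r) ℚ) ^ m j)

/-- The determinant of the matrix which takes the columns of `h`'s to those of powers. -/
def cofactorDet (r : ℕ) : MvPolynomial (Fin r) ℚ :=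
  Matrix.det (Matrix.of fun i l : Fin r => (cofactor r i).coeff (r - 1 - l))

theorem alternant_eq (r : ℕ) (m : Fin r → ℕ) :
    alternant r m = cofactorDet r *
      toSymm r (toBoson r (exteriorPower.ιMulti ℚ r fun j => b (m j))) := by
  rw [toBoson_ιMulti, AlgHom.map_det, alternant, cofactorDet, ← Matrix.det_mul]
  congr 1
  ext i j : 2
  rw [Matrix.of_apply, pow_eq_sum, Matrix.mul_apply]
  rfl

theorem h_zero (r : ℕ) : h r 0 = 1 := by
  simp [h]

theorem h_neg (r : ℕ) (j : ℤ) (hj : j < 0) : h r j = 0 := by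
  rw [h, if_neg (by omega)]

theorem toBoson_vacuum (r : ℕ) :
    toBoson r (exteriorPower.ιMulti ℚ r fun j => b (r - 1 - j)) = 1 := by
  rw [toBoson_ιMulti, Matrix.det_of_isLowerTriangular]
  · refine Finset.prod_eq_one fun i _ => ?_
    rw [Matrix.of_apply, ← h_zero r]
    congr 1
    have := i.2
    omega
  · intro i j hij
    rw [Matrix.of_apply]
    apply h_neg
    have h1 : i < j := hij
    have := j.2
    omega

theorem cofactorDet_eq (r : ℕ) : cofactorDet r = alternant r fun j => r - 1 - j := by
  rw [alternant_eq, toBoson_vacuum, map_one, mul_one]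

/-- The `ℚ`-linear map `ℚ[y_1, …, y_r] → ⋀^r V` sending `y^m` to `b_{m_1} ∧ ⋯ ∧ b_{m_r}`. -/
def monomialToWedge (r : ℕ) : MvPolynomial (Fin r) ℚ →ₗ[ℚ] ⋀[ℚ]^r V :=
  (MvPolynomial.basisMonomials (Fin r) ℚ).constr ℚ
    fun d => exteriorPower.ιMulti ℚ r fun j => b (d j)

theorem monomialToWedge_monomial (r : ℕ) (d : Fin r →₀ ℕ) :
    monomialToWedge r (MvPolynomial.monomial d 1) =
      exteriorPower.ιMulti ℚ r fun j => b (d j) := by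
  have := (MvPolynomial.basisMonomials (Fin r) ℚ).constr_basis ℚ
    (fun d => exteriorPower.ιMulti ℚ r fun j => b (d j)) d
  simpa [monomialToWedge] using this

theorem prod_X_eq (r : ℕ) (s : Equiv.Perm (Fin r)) (m : Fin r → ℕ) :
    ∏ i, (MvPolynomial.X (s i) : MvPolynomial (Fin r) ℚ) ^ m i =
      MvPolynomial.monomial (Finsupp.equivFunOnFinite.symm (m ∘ s.symm)) 1 := by
  rw [MvPolynomial.monomial_eq, Finsupp.prod_fintype _ _ (by simp),
    ← Equiv.prod_comp s fun i => MvPolynomial.X i ^ _]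
  simp

theorem monomialToWedge_alternant (r : ℕ) (m : Fin r → ℕ) :
    monomialToWedge r (alternant r m) =
      (r.factorial : ℚ) • exteriorPower.ιMulti ℚ r fun j => b (m j) := by
  have h1 : ∀ s : Equiv.Perm (Fin r), monomialToWedge r (Equiv.Perm.sign s •
      ∏ i, (MvPolynomial.X (s i) : MvPolynomial (Fin r) ℚ) ^ m i) =
      exteriorPower.ιMulti ℚ r fun j => b (m j) := by
    intro s
    rw [prod_X_eq, Units.smul_def, map_zsmul, monomialToWedge_monomial]
    have := (exteriorPower.ιMulti ℚ (M := V) r).map_perm (fun j => b (m j)) s.symm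
    simp only [Function.comp_def] at this
    simp only [Finsupp.equivFunOnFinite_symm_apply_apply, Function.comp_apply]
    rw [this, ← Units.smul_def, smul_smul, Equiv.Perm.sign_symm, Int.units_mul_self, one_smul]
  rw [alternant, Matrix.det_apply, map_sum]
  simp only [Matrix.of_apply]
  simp_rw [h1]
  simp [Fintype.card_perm, ← Nat.cast_smul_eq_nsmul ℚ]

/-- The map `⋀^r V → ℚ[y_1, …, y_r]`, `b_{m_1} ∧ ⋯ ∧ b_{m_r} ↦ det (y_i ^ {m_j})`. -/
def wedgeToAlternant (r : ℕ) : ⋀[ℚ]^r V →ₗ[ℚ] MvPolynomial (Fin r) ℚ :=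
  LinearMap.mulLeft ℚ (cofactorDet r) ∘ₗ (toSymm r).toLinearMap ∘ₗ toBoson r

theorem wedgeToAlternant_apply (r : ℕ) (m : Fin r → ℕ) :
    wedgeToAlternant r (exteriorPower.ιMulti ℚ r fun j => b (m j)) = alternant r m :=
  (alternant_eq r m).symm

theorem monomialToWedge_wedgeToAlternant (r : ℕ) (u : ⋀[ℚ]^r V) :
    monomialToWedge r (wedgeToAlternant r u) = (r.factorial : ℚ) • u := by
  have : monomialToWedge r ∘ₗ wedgeToAlternant r = (r.factorial : ℚ) • LinearMap.id := by
    apply exteriorPower.linearMap_ext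
    apply Module.Basis.ext_alternating (Finsupp.basisSingleOne (R := ℚ) (ι := ℕ))
    intro m _
    have := wedgeToAlternant_apply r m
    have h2 := monomialToWedge_alternant r m
    rw [← this] at h2
    simpa [b] using h2
  exact LinearMap.congr_fun this u

theorem wedgeToAlternant_monomialToWedge (r : ℕ) (p : MvPolynomial (Fin r) ℚ) :
    wedgeToAlternant r (monomialToWedge r p) =
      ∑ s : Equiv.Perm (Fin r), Equiv.Perm.sign s • MvPolynomial.rename s p := by
  have : wedgeToAlternant r ∘ₗ monomialToWedge r =
      ∑ s : Equiv.Perm (Fin r), (Equiv.Perm.sign s : ℤ) •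
        (MvPolynomial.rename (R := ℚ) s).toLinearMap := by
    apply (MvPolynomial.basisMonomials (Fin r) ℚ).ext
    intro d
    rw [MvPolynomial.coe_basisMonomials, LinearMap.comp_apply, monomialToWedge_monomial,
      wedgeToAlternant_apply, alternant, Matrix.det_apply, LinearMap.sum_apply]
    refine Finset.sum_congr rfl fun s _ => ?_
    simp only [Matrix.of_apply]
    rw [LinearMap.smul_apply, Units.smul_def, MvPolynomial.monomial_eq,
      Finsupp.prod_fintype _ _ (by simp)]
    simp
  rw [← LinearMap.comp_apply, this, LinearMap.sum_apply]
  rfl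

theorem rename_alternant (r : ℕ) (m : Fin r → ℕ) (s : Equiv.Perm (Fin r)) :
    MvPolynomial.rename s (alternant r m) = Equiv.Perm.sign s • alternant r m := by
  have := Matrix.det_permute s
    (Matrix.of fun i j : Fin r => (MvPolynomial.X i : MvPolynomial (Fin r) ℚ) ^ m j)
  rw [Units.smul_def, zsmul_eq_mul, alternant, ← this, AlgHom.map_det]
  congr 1
  ext i j : 2
  simp

theorem rename_toSymm (r : ℕ) (f : B r) (s : Equiv.Perm (Fin r)) :
    MvPolynomial.rename s (toSymm r f) = toSymm r f := by
  have : (MvPolynomial.rename s).comp (toSymm r) = toSymm r := by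
    apply MvPolynomial.algHom_ext
    intro i
    simp [toSymm, MvPolynomial.rename_esymm]
  exact DFunLike.congr_fun this f

theorem toSymm_injective (r : ℕ) : Function.Injective (toSymm r) := by
  intro f g hfg
  apply MvPolynomial.esymmAlgHom_injective (σ := Fin r) (R := ℚ) (n := r) (by simp)
  apply Subtype.ext
  rw [MvPolynomial.esymmAlgHom_apply, MvPolynomial.esymmAlgHom_apply]
  exact hfg

theorem factorial_ne (r : ℕ) : (r.factorial : ℚ) ≠ 0 := by
  exact_mod_cast r.factorial_ne_zero

theorem toBoson_injective (r : ℕ) : Function.Injective (toBoson r) := by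
  rw [injective_iff_map_eq_zero]
  intro u hu
  have h1 := monomialToWedge_wedgeToAlternant r u
  simp only [wedgeToAlternant, LinearMap.comp_apply, hu, map_zero] at h1
  exact (smul_eq_zero.1 h1.symm).resolve_left (factorial_ne r)

theorem cofactorDet_ne_zero (r : ℕ) : cofactorDet r ≠ 0 := by
  intro h0
  have h1 := monomialToWedge_alternant r fun j => r - 1 - j
  rw [← cofactorDet_eq, h0, map_zero] at h1
  have h2 := congrArg (toBoson r) h1
  rw [map_zero, map_smul, toBoson_vacuum] at h2
  exact factorial_ne r ((smul_eq_zero.1 h2.symm).resolve_right one_ne_zero)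

theorem toBoson_surjective (r : ℕ) : Function.Surjective (toBoson r) := by
  intro f
  refine ⟨(r.factorial : ℚ)⁻¹ • monomialToWedge r (cofactorDet r * toSymm r f), ?_⟩
  have h1 := wedgeToAlternant_monomialToWedge r (cofactorDet r * toSymm r f)
  have h2 : ∀ s : Equiv.Perm (Fin r), Equiv.Perm.sign s •
      MvPolynomial.rename s (cofactorDet r * toSymm r f) = cofactorDet r * toSymm r f := by
    intro s
    rw [map_mul, rename_toSymm, cofactorDet_eq, rename_alternant, smul_mul_assoc, smul_smul,
      Int.units_mul_self, one_smul]
  simp_rw [h2] at h1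
  have h3 : cofactorDet r * toSymm r (toBoson r (monomialToWedge r (cofactorDet r * toSymm r f))) =
      cofactorDet r * toSymm r ((r.factorial : ℚ) • f) := by
    have h4 : wedgeToAlternant r (monomialToWedge r (cofactorDet r * toSymm r f)) =
      cofactorDet r *
        toSymm r (toBoson r (monomialToWedge r (cofactorDet r * toSymm r f))) := rfl
    rw [← h4, h1, map_smul, mul_smul_comm]
    simp [Fintype.card_perm, ← Nat.cast_smul_eq_nsmul ℚ]
  have h5 := toSymm_injective r (mul_left_cancel₀ (cofactorDet_ne_zero r) h3)
  rw [map_smul, h5, smul_smul, inv_mul_cancel₀ (factorial_ne r), one_smul]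

/-- The natural isomorphism `⋀^r V ≃ B_r`, `[b]^r_λ ↦ Δ_λ(H_r)` (see `toBoson_wedge`). -/
def boson (r : ℕ) : (⋀[ℚ]^r V) ≃ₗ[ℚ] B r :=
  LinearEquiv.ofBijective (toBoson r) ⟨toBoson_injective r, toBoson_surjective r⟩

/-! ### The action of `⋀^k V ⊗ ⋀^k V^*` on `B_r` -/

/-- The linear form `β_j` on `V`, with `β_j(b_i) = δ_{ij}`. -/
def beta (j : ℕ) : Module.Dual ℚ V := Finsupp.lapply j

/-- The element `[β]^k_ν = β_{k-1+ν_1} ∧ ⋯ ∧ β_{ν_k}`. -/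
def wedgeBeta (k : ℕ) (n : Part k) : ExteriorAlgebra ℚ (Module.Dual ℚ V) :=
  ExteriorAlgebra.ιMulti ℚ k fun j => beta (k - 1 - j + n j)

/-- The contraction `ω ⌟ u`. For a linear form `β` it is the antiderivation
`β ⌟ (u_1 ∧ u_2 ∧ ⋯) = β(u_1) u_2 ∧ ⋯ - u_1 ∧ (β ⌟ (u_2 ∧ ⋯))`; in general
`(ω ∧ ω') ⌟ u = ω' ⌟ (ω ⌟ u)`, which is the rule for which `η(ω ⌟ u) = (ω ∧ η)(u)` under the
determinantal pairing of forms with multivectors. -/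
def contract : ExteriorAlgebra ℚ (Module.Dual ℚ V) →ₐ[ℚ]
    (Module.End ℚ (ExteriorAlgebra ℚ V))ᵐᵒᵖ :=
  ExteriorAlgebra.lift ℚ
    ⟨(MulOpposite.opLinearEquiv ℚ).toLinearMap ∘ₗ
        (CliffordAlgebra.contractLeft (Q := (0 : QuadraticForm ℚ V))), fun d => by
      rw [LinearMap.comp_apply]
      apply MulOpposite.unop_injective
      refine LinearMap.ext fun x => ?_
      exact CliffordAlgebra.contractLeft_contractLeft d x⟩

theorem contract_ι_mul (d : Module.Dual ℚ V) (o : ExteriorAlgebra ℚ (Module.Dual ℚ V))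
    (u : ExteriorAlgebra ℚ V) :
    (contract (ExteriorAlgebra.ι ℚ d * o)).unop u =
      (contract o).unop (CliffordAlgebra.contractLeft (Q := (0 : QuadraticForm ℚ V)) d u) := by
  rw [map_mul, MulOpposite.unop_mul, Module.End.mul_apply, contract, ExteriorAlgebra.lift_ι_apply]
  rfl

theorem contractLeft_ιMulti_mem (d : Module.Dual ℚ V) (n : ℕ) (v : Fin (n + 1) → V) :
    CliffordAlgebra.contractLeft (Q := (0 : QuadraticForm ℚ V)) d
      (ExteriorAlgebra.ιMulti ℚ (n + 1) v) ∈ ⋀[ℚ]^n V := by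
  induction n with
  | zero =>
    rw [ExteriorAlgebra.ιMulti_succ_apply, ExteriorAlgebra.ιMulti_zero_apply, mul_one]
    refine (CliffordAlgebra.contractLeft_ι (Q := (0 : QuadraticForm ℚ V)) d (v 0)).symm ▸ ?_
    exact SetLike.algebraMap_mem_graded (fun i : ℕ => ⋀[ℚ]^i V) _
  | succ n ih =>
    rw [ExteriorAlgebra.ιMulti_succ_apply]
    refine (CliffordAlgebra.contractLeft_ι_mul (Q := (0 : QuadraticForm ℚ V)) d (v 0) _).symm ▸ ?_
    refine Submodule.sub_mem _ (Submodule.smul_mem _ _ ?_) ?_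
    · exact ExteriorAlgebra.ιMulti_range ℚ (n + 1) (Set.mem_range_self _)
    · have h1 : ExteriorAlgebra.ι ℚ (v 0) ∈ ⋀[ℚ]^1 V := by
        simp [ExteriorAlgebra.exteriorPower]
      have := SetLike.mul_mem_graded (A := fun i : ℕ => ⋀[ℚ]^i V) h1 (ih (Matrix.vecTail v))
      rw [add_comm] at this
      exact this

theorem contractLeft_mem (d : Module.Dual ℚ V) (n : ℕ) (u : ExteriorAlgebra ℚ V)
    (hu : u ∈ ⋀[ℚ]^(n + 1) V) :
    CliffordAlgebra.contractLeft (Q := (0 : QuadraticForm ℚ V)) d u ∈ ⋀[ℚ]^n V := by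
  rw [← ExteriorAlgebra.ιMulti_span_fixedDegree] at hu
  induction hu using Submodule.span_induction with
  | mem x hx =>
    obtain ⟨v, rfl⟩ := hx
    exact contractLeft_ιMulti_mem d n v
  | zero => rw [map_zero]; exact Submodule.zero_mem _
  | add x y _ _ hx hy => rw [map_add]; exact Submodule.add_mem _ hx hy
  | smul c x _ hx => rw [map_smul]; exact Submodule.smul_mem _ _ hx

theorem contractLeft_zero_degree (d : Module.Dual ℚ V) (u : ExteriorAlgebra ℚ V)
    (hu : u ∈ ⋀[ℚ]^0 V) :
    CliffordAlgebra.contractLeft (Q := (0 : QuadraticForm ℚ V)) d u = 0 := by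
  rw [ExteriorAlgebra.exteriorPower, pow_zero, Submodule.mem_one] at hu
  obtain ⟨c, rfl⟩ := hu
  exact CliffordAlgebra.contractLeft_algebraMap (Q := (0 : QuadraticForm ℚ V)) d c

theorem contract_mem (k : ℕ) (v : Fin k → Module.Dual ℚ V) (n : ℕ) (u : ExteriorAlgebra ℚ V)
    (hu : u ∈ ⋀[ℚ]^n V) :
    (k ≤ n → (contract (ExteriorAlgebra.ιMulti ℚ k v)).unop u ∈ ⋀[ℚ]^(n - k) V) ∧
      (n < k → (contract (ExteriorAlgebra.ιMulti ℚ k v)).unop u = 0) := by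
  induction k generalizing n u with
  | zero =>
    rw [ExteriorAlgebra.ιMulti_zero_apply, map_one]
    exact ⟨fun _ => hu, fun h0 => absurd h0 (Nat.not_lt_zero n)⟩
  | succ k ih =>
    rw [ExteriorAlgebra.ιMulti_succ_apply, contract_ι_mul]
    cases n with
    | zero =>
      rw [contractLeft_zero_degree (v 0) u hu, map_zero]
      exact ⟨fun _ => Submodule.zero_mem _, fun _ => rfl⟩
    | succ n =>
      have h1 := ih (Matrix.vecTail v) n _ (contractLeft_mem (v 0) n u hu)
      rw [Nat.add_sub_add_right]
      exact ⟨fun h2 => h1.1 (by omega), fun h2 => h1.2 (by omega)⟩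

theorem wedge_contract_mem (r k : ℕ) (m n : Part k) (u : ExteriorAlgebra ℚ V)
    (hu : u ∈ ⋀[ℚ]^r V) :
    (wedge k m : ExteriorAlgebra ℚ V) * (contract (wedgeBeta k n)).unop u ∈ ⋀[ℚ]^r V := by
  have h1 := contract_mem k (fun j => beta (k - 1 - j + n j)) r u hu
  rcases le_or_gt k r with hk | hk
  · have := SetLike.mul_mem_graded (A := fun i : ℕ => ⋀[ℚ]^i V) (wedge k m).2 (h1.1 hk)
    rw [Nat.add_sub_cancel' hk] at this
    exact this
  · rw [wedgeBeta, h1.2 hk, mul_zero]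
    exact Submodule.zero_mem _

/-- The endomorphism `u ↦ [b]^k_μ ∧ ([β]^k_ν ⌟ u)` of `⋀^r V`. -/
def wedgeAction (r k : ℕ) (m n : Part k) : ⋀[ℚ]^r V →ₗ[ℚ] ⋀[ℚ]^r V :=
  (LinearMap.mulLeft ℚ (wedge k m : ExteriorAlgebra ℚ V) ∘ₗ
    (contract (wedgeBeta k n)).unop).restrict fun u hu => wedge_contract_mem r k m n u hu

/-- The action of `[b]^k_μ ⊗ [β]^k_ν` on `B_r`, transported from `⋀^r V`. -/
def action (r k : ℕ) (m n : Part k) : B r →ₗ[ℚ] B r :=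
  (boson r).toLinearMap ∘ₗ wedgeAction r k m n ∘ₗ (boson r).symm.toLinearMap

/-! ### Schur polynomials -/

/-- The alternating polynomial `Δ_μ(x_1, …, x_k) = det (x_j ^ {μ_{k-i+1} + i - 1})`. -/
def alternating (k : ℕ) (m : Part k) : MvPolynomial (Fin k) ℚ :=
  Matrix.det (Matrix.of fun i j : Fin k => MvPolynomial.X j ^ (m i.rev + i))

/-- The partition with all parts equal to zero. -/
def zeroPart (k : ℕ) : Part k := ⟨fun _ => 0, antitone_const⟩

theorem alternating_eq (k : ℕ) (m : Part k) :
    alternating k m = Equiv.Perm.sign (Fin.revPerm (n := k)) •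
      (cofactorDet k * toSymm k (toBoson k (wedge k m))) := by
  have h1 : alternating k m = alternant k fun i => m i.rev + i := by
    rw [alternating, alternant, ← Matrix.det_transpose]
    rfl
  have h2 := (exteriorPower.ιMulti ℚ (M := V) k).map_perm
    (fun j => b (k - 1 - j + m j)) Fin.revPerm
  have h3 : ((fun j : Fin k => b (k - 1 - j + m j)) ∘ Fin.revPerm) =
      fun j : Fin k => b (m j.rev + j) := by
    funext j
    have := j.2
    simp only [Function.comp_apply, Fin.revPerm_apply, Fin.val_rev]
    congr 1
    omega
  rw [h3] at h2
  rw [h1, alternant_eq, h2, wedge, Units.smul_def, Units.smul_def, map_zsmul, map_zsmul,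
    mul_smul_comm]

theorem alternating_zero (k : ℕ) : alternating k (zeroPart k) =
    Equiv.Perm.sign (Fin.revPerm (n := k)) • cofactorDet k := by
  have : toBoson k (wedge k (zeroPart k)) = 1 := toBoson_vacuum k
  rw [alternating_eq, this, map_one, mul_one]

theorem alternating_dvd (k : ℕ) (m : Part k) :
    ∃ s : MvPolynomial (Fin k) ℚ, alternating k m = s * alternating k (zeroPart k) :=
  ⟨toSymm k (toBoson k (wedge k m)), by
    rw [alternating_zero, alternating_eq, mul_smul_comm, mul_comm (cofactorDet k)]⟩

/-- The Schur polynomial `s_μ`, the quotient of `Δ_μ` by the Vandermonde determinant `Δ_0`. -/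
def schur (k : ℕ) (m : Part k) : MvPolynomial (Fin k) ℚ :=
  Classical.choose (alternating_dvd k m)

theorem schur_mul_alternating (k : ℕ) (m : Part k) :
    alternating k m = schur k m * alternating k (zeroPart k) :=
  Classical.choose_spec (alternating_dvd k m)

theorem alternating_zero_ne_zero (k : ℕ) : alternating k (zeroPart k) ≠ 0 := by
  rw [alternating_zero]
  exact (smul_ne_zero_iff_ne _).2 (cofactorDet_ne_zero k)

/-! ### The generating function -/

/-- The formal series `𝓔(z, w⁻¹) f = ∑_{μ, ν} s_μ(z) s_ν(w⁻¹) ([b]^k_μ ⊗ [β]^k_ν) f`, given by its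
coefficients. The variable `Sum.inl j` is `z_j` and the variable `Sum.inr j` is `w_j⁻¹`. For a given
monomial only finitely many pairs `(μ, ν)` contribute, since `s_μ` is homogeneous of degree `|μ|`. -/
def generating (r k : ℕ) (f : B r) : MvPowerSeries (Fin k ⊕ Fin k) (B r) := fun d =>
  ∑ᶠ p : Part k × Part k,
    MvPolynomial.coeff d (MvPolynomial.rename Sum.inl (schur k p.1) *
      MvPolynomial.rename Sum.inr (schur k p.2)) • action r k p.1 p.2 f

instance (r k : ℕ) : IsDomain (MvPowerSeries (Fin k ⊕ Fin k) (B r)) :=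
  NoZeroDivisors.to_isDomain _

/-- The fraction field of `B_r⟦z_1, …, z_k, w_1⁻¹, …, w_k⁻¹⟧`, in which all formulas take place. -/
abbrev K (r k : ℕ) : Type := FractionRing (MvPowerSeries (Fin k ⊕ Fin k) (B r))

/-- The formal variable `z_j`. -/
def z (r k : ℕ) (j : Fin k) : K r k :=
  algebraMap (MvPowerSeries (Fin k ⊕ Fin k) (B r)) (K r k) (MvPowerSeries.X (Sum.inl j))

/-- The formal variable `w_j`, the inverse of the variable `Sum.inr j` of the power series ring. -/
def w (r k : ℕ) (j : Fin k) : K r k :=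
  (algebraMap (MvPowerSeries (Fin k ⊕ Fin k) (B r)) (K r k) (MvPowerSeries.X (Sum.inr j)))⁻¹

/-! ### The Schubert derivation `σ̄_-` -/

/-- The endomorphism `σ_{-1}` of `V`: `b_j ↦ b_{j-1}` for `j ≥ 1` and `b_0 ↦ 0`. -/
def shift : V →ₗ[ℚ] V :=
  Finsupp.linearCombination ℚ fun j => if j = 0 then 0 else b (j - 1)

/-- The Schubert derivation `σ̄_-(T⁻¹) : ⋀V → ⋀V[T]`, the Hasse-Schmidt derivation (algebra
homomorphism) such that `v ↦ v - σ_{-1}(v) T` for `v ∈ V`. The polynomial variable `T` stands for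
the inverse of the formal variable in `σ̄_-(z)`. -/
def sigmaBar : ExteriorAlgebra ℚ V →ₐ[ℚ] Polynomial (ExteriorAlgebra ℚ V) :=
  ExteriorAlgebra.lift ℚ
    ⟨((Polynomial.monomial 0).restrictScalars ℚ) ∘ₗ ExteriorAlgebra.ι ℚ -
        ((Polynomial.monomial 1).restrictScalars ℚ) ∘ₗ ExteriorAlgebra.ι ℚ ∘ₗ shift, fun v => by
      have h1 := ExteriorAlgebra.ι_add_mul_swap (R := ℚ) (shift v) v
      simp only [LinearMap.sub_apply, LinearMap.comp_apply, LinearMap.restrictScalars_apply,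
        sub_mul, mul_sub, Polynomial.monomial_mul_monomial, ExteriorAlgebra.ι_sq_zero, map_zero,
        zero_sub, sub_zero, zero_add, add_zero]
      rw [← neg_add', neg_eq_zero, ← map_add, h1, map_zero]⟩

theorem sigmaBar_ι (v : V) : sigmaBar (ExteriorAlgebra.ι ℚ v) =
    Polynomial.monomial 0 (ExteriorAlgebra.ι ℚ v) -
      Polynomial.monomial 1 (ExteriorAlgebra.ι ℚ (shift v)) := by
  rw [sigmaBar, ExteriorAlgebra.lift_ι_apply]
  rfl

/-- The coefficient of `z^{-i}` in `σ̄_-(z)`, as an endomorphism of `⋀V`. -/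
def sigmaBarCoeff (i : ℕ) : ExteriorAlgebra ℚ V →ₗ[ℚ] ExteriorAlgebra ℚ V :=
  (Polynomial.lcoeff (ExteriorAlgebra ℚ V) i).restrictScalars ℚ ∘ₗ sigmaBar.toLinearMap

theorem sigmaBarCoeff_ιMulti (n i : ℕ) (v : Fin n → V) :
    sigmaBarCoeff i (ExteriorAlgebra.ιMulti ℚ n v) ∈ ⋀[ℚ]^n V ∧
      (n < i → sigmaBarCoeff i (ExteriorAlgebra.ιMulti ℚ n v) = 0) := by
  induction n generalizing i with
  | zero =>
    have h1 : sigmaBarCoeff i (ExteriorAlgebra.ιMulti ℚ 0 v) = if i = 0 then 1 else 0 := by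
      rw [ExteriorAlgebra.ιMulti_zero_apply]
      simp [sigmaBarCoeff, Polynomial.coeff_one]
    rw [h1]
    refine ⟨?_, fun hi => if_neg (by omega)⟩
    split_ifs
    · exact SetLike.one_mem_graded (fun i : ℕ => ⋀[ℚ]^i V)
    · exact Submodule.zero_mem _
  | succ n ih =>
    have hv : ∀ x : V, ExteriorAlgebra.ι ℚ x ∈ ⋀[ℚ]^1 V := fun x => by simp [ExteriorAlgebra.exteriorPower]
    have hm : ∀ (x : V) (y : ExteriorAlgebra ℚ V), y ∈ ⋀[ℚ]^n V →
        ExteriorAlgebra.ι ℚ x * y ∈ ⋀[ℚ]^(n + 1) V := fun x y hy => by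
      have := SetLike.mul_mem_graded (A := fun i : ℕ => ⋀[ℚ]^i V) (hv x) hy
      rw [add_comm] at this
      exact this
    have h0 : sigmaBarCoeff i (ExteriorAlgebra.ιMulti ℚ (n + 1) v) =
        ExteriorAlgebra.ι ℚ (v 0) *
            sigmaBarCoeff i (ExteriorAlgebra.ιMulti ℚ n (Matrix.vecTail v)) -
          if i = 0 then 0 else ExteriorAlgebra.ι ℚ (shift (v 0)) *
            sigmaBarCoeff (i - 1) (ExteriorAlgebra.ιMulti ℚ n (Matrix.vecTail v)) := by
      rw [ExteriorAlgebra.ιMulti_succ_apply]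
      simp only [sigmaBarCoeff, LinearMap.comp_apply, AlgHom.toLinearMap_apply, map_mul,
        sigmaBar_ι, sub_mul, LinearMap.restrictScalars_apply, Polynomial.lcoeff_apply,
        Polynomial.coeff_sub]
      congr 1
      · rw [Polynomial.monomial_zero_left, Polynomial.coeff_C_mul]
      · cases i with
        | zero => simp [← Polynomial.C_mul_X_eq_monomial, mul_assoc]
        | succ i =>
          rw [← Polynomial.C_mul_X_eq_monomial, mul_assoc, Polynomial.coeff_C_mul,
            Polynomial.coeff_X_mul]
          simp
    rw [h0]
    refine ⟨Submodule.sub_mem _ (hm _ _ (ih i _).1) ?_, fun hi => ?_⟩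
    · split_ifs
      · exact Submodule.zero_mem _
      · exact hm _ _ (ih _ _).1
    · rw [(ih i _).2 (by omega), (ih (i - 1) _).2 (by omega)]
      simp

theorem sigmaBarCoeff_mem (n i : ℕ) (u : ExteriorAlgebra ℚ V) (hu : u ∈ ⋀[ℚ]^n V) :
    sigmaBarCoeff i u ∈ ⋀[ℚ]^n V ∧ (n < i → sigmaBarCoeff i u = 0) := by
  rw [← ExteriorAlgebra.ιMulti_span_fixedDegree] at hu
  induction hu using Submodule.span_induction with
  | mem x hx =>
    obtain ⟨v, rfl⟩ := hx
    exact sigmaBarCoeff_ιMulti n i v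
  | zero => rw [map_zero]; exact ⟨Submodule.zero_mem _, fun _ => rfl⟩
  | add x y _ _ hx hy =>
    rw [map_add]
    exact ⟨Submodule.add_mem _ hx.1 hy.1, fun hi => by rw [hx.2 hi, hy.2 hi, add_zero]⟩
  | smul c x _ hx =>
    rw [map_smul]
    exact ⟨Submodule.smul_mem _ _ hx.1, fun hi => by rw [hx.2 hi, smul_zero]⟩

/-- The coefficient of `z^{-i}` in `σ̄_-(z) : B_r → B_r[z⁻¹]`, transported from `⋀^r V`. It is zero
for `i > r` by `sigmaBarCoeff_mem`. -/
def sigmaBarBoson (r i : ℕ) : B r →ₗ[ℚ] B r :=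
  (boson r).toLinearMap ∘ₗ
    (sigmaBarCoeff i).restrict (fun u hu => (sigmaBarCoeff_mem r i u hu).1) ∘ₗ
      (boson r).symm.toLinearMap

/-- `σ̄_-(z_1, …, z_k) f`, where `σ̄_-(z_1, …, z_k) = σ̄_-(z_1) ∘ ⋯ ∘ σ̄_-(z_k)`: the sum over
`i_1, …, i_k` of `z_1^{-i_1} ⋯ z_k^{-i_k}` times the composition of the coefficient operators of
indices `i_1, …, i_k`, applied to `f`. -/
def sigmaBarMulti (r k : ℕ) (f : B r) : K r k :=
  ∑ i : Fin k → Fin (r + 1),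
    algebraMap (B r) (K r k) ((List.ofFn fun j => sigmaBarBoson r (i j)).prod f) *
      ∏ j, (z r k j)⁻¹ ^ (i j : ℕ)

/-- The deformed Giambelli determinant `Δ_λ(w⁻¹, σ̄_-(z) H_r)`: for `i ≤ k` the `(i, j)` entry is
`w_i^{-(λ_j - j + i)}`, and for `k < i ≤ r` it is `σ̄_-(z) h_{λ_j - j + i}`. -/
def deformedDet (r k : ℕ) (l : Part r) : K r k :=
  Matrix.det (Matrix.of fun i j : Fin r =>
    if hi : (i : ℕ) < k then w r k ⟨i, hi⟩ ^ (-((l j : ℤ) - (j : ℕ) + (i : ℕ)))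
    else sigmaBarMulti r k (h r ((l j : ℤ) - (j : ℕ) + (i : ℕ))))

end

end BosonicRep

namespace BosonicRep

noncomputable section

/-! Write `r = k + q`, `u = b_{m_1} ∧ ⋯ ∧ b_{m_r}` with `m_j = r - j + λ_j`, and multiply the
generating function by the Vandermonde determinants in the `z_c` and in the `w_c⁻¹`. This turns each
Schur polynomial into an alternant. Since wedge products are alternating, a sum of alternants over
partitions unfolds into an unrestricted sum over exponent vectors (`sum_coeff_alternant`): the
coefficient of `z^d w^{-n}` in the product is the image in `B_r` of `b_{d_1} ∧ ⋯ ∧ b_{d_k} ∧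
((β_{n_1} ∧ ⋯ ∧ β_{n_k}) ⌟ u)`.

The isomorphism with `B_r` is a determinant whose columns are linear in the vectors. Summing over
`d` replaces the column of `b_{d_c}` by the geometric column `z_c^{r-1-i} / E_r(z_c)`, `0 ≤ i < r`.
The recurrence with characteristic polynomial `∏ (1 - z_c⁻¹ T)` annihilates these columns. Applied
to the last `q` rows it makes the matrix block triangular and changes `h_j` into `∑_s (-1)^s
e_s(z⁻¹) h_{j-s}` in the other columns (`det_append_geometric`). What splits off is `∏ z_c^q /
E_r(z_c)` times the Vandermonde determinant in `z`.

A determinant of size `q` evaluated on a contraction by `k` forms is a determinant of size `k + q`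
with these forms as its first rows (`detLinear_contract`, iterated Laplace expansion). Summing over
`n` makes these rows `w_c^{-m_j}`, which is `Δ_λ(w⁻¹, σ̄_-(z) H_r)` up to a power of `w_c` in each
row. Dividing by the nonzero Vandermonde determinants gives the formula.

It remains to see that the sums above are `σ̄_-(z_1, …, z_k) h_j`. For `r = n + 1`, `h_j` with `j ≥
0` is the image of `b_{n+j} ∧ b_{n-1} ∧ ⋯ ∧ b_0`, and `σ̄_-` fixes `b_{n-1} ∧ ⋯ ∧ b_0`. So `σ̄_-(z)
h_j = h_j - z⁻¹ h_{j-1}`, which is iterated over the `z_c` (`sum_sigmaBarBoson_h`). -/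

/-! ### The polynomial `∏ (1 - y_c T)` -/

/-- The polynomial `∏_c (1 - y_c T)`. -/
def linearProd {K : Type*} [CommRing K] {k : ℕ} (y : Fin k → K) : Polynomial K :=
  ∏ c, (1 - Polynomial.C (y c) * Polynomial.X)

theorem linearProd_coeff_of_lt {K : Type*} [CommRing K] {k : ℕ} (y : Fin k → K) {n : ℕ}
    (hn : k < n) : (linearProd y).coeff n = 0 := by
  apply Polynomial.coeff_eq_zero_of_natDegree_lt
  have h1 : (linearProd y).natDegree ≤ ∑ c : Fin k, 1 := by
    refine (Polynomial.natDegree_prod_le _ _).trans (Finset.sum_le_sum fun j _ => ?_)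
    compute_degree
  simp at h1
  omega

theorem linearProd_coeff_zero {K : Type*} [CommRing K] {k : ℕ} (y : Fin k → K) :
    (linearProd y).coeff 0 = 1 := by
  simp [linearProd, Polynomial.coeff_zero_eq_eval_zero, Polynomial.eval_prod]

/-- The sum is the value of the polynomial at `x c`, a root of its factor of index `c`. This is the
recurrence that annihilates geometric columns. -/
theorem linearProd_sum_coeff {K : Type*} [Field K] {k : ℕ} (x : Fin k → K) (hx : ∀ c, x c ≠ 0)
    (c : Fin k) : ∑ s ∈ Finset.range (k + 1), (linearProd fun a => (x a)⁻¹).coeff s * x c ^ s = 0 := by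
  have h1 : (linearProd fun a => (x a)⁻¹).natDegree < k + 1 := by
    rw [Nat.lt_succ_iff, Polynomial.natDegree_le_iff_coeff_eq_zero]
    exact fun n hn => linearProd_coeff_of_lt _ hn
  rw [← Polynomial.eval_eq_sum_range' h1, linearProd, Polynomial.eval_prod]
  exact Finset.prod_eq_zero (Finset.mem_univ c) (by simp [hx c])

/-- Specialization at `y` of the universal factorization `map_E`. -/
theorem linearProd_coeff {K : Type*} [CommRing K] [Algebra ℚ K] {k : ℕ} (y : Fin k → K) {s : ℕ}
    (hs : s ≤ k) : (linearProd y).coeff s =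
      (-1) ^ s * MvPolynomial.aeval y (MvPolynomial.esymm (Fin k) ℚ s) := by
  have h1 : linearProd y = (linearProd (MvPolynomial.X (R := ℚ))).map
      (MvPolynomial.aeval (R := ℚ) y).toRingHom := by
    simp [linearProd, Polynomial.map_prod]
  have h2 : (E k).coeff s = (-1) ^ s * e k s := by
    simp only [E, Polynomial.finsetSum_coeff, Polynomial.coeff_monomial]
    rw [Finset.sum_ite_eq' , if_pos (Finset.mem_range.2 (by omega))]
  rw [h1, linearProd, ← map_E, Polynomial.coeff_map, Polynomial.coeff_map, h2]
  simp [toSymm_e k s hs]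

theorem linearProd_snoc {K : Type*} [CommRing K] {k : ℕ} (y : Fin (k + 1) → K) (s : ℕ) :
    (linearProd y).coeff (s + 1) = (linearProd fun c : Fin k => y c.castSucc).coeff (s + 1) -
      y (Fin.last k) * (linearProd fun c : Fin k => y c.castSucc).coeff s := by
  rw [linearProd, Fin.prod_univ_castSucc, mul_sub, mul_one, ← linearProd, mul_left_comm,
    Polynomial.coeff_sub, Polynomial.coeff_C_mul, Polynomial.coeff_mul_X]

/-! ### Determinants as functions on the exterior algebra -/

section detForm

variable {S : Type*} [CommRing S] [Algebra ℚ S]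

/-- The alternating map `(v_1, …, v_q) ↦ det (ζ_i (v_j))`. -/
def detForm (q : ℕ) (ζ : ℕ → V →ₗ[ℚ] S) : V [⋀^Fin q]→ₗ[ℚ] S where
  toMultilinearMap :=
    ((Matrix.detRowAlternating (n := Fin q) (R := S)).toMultilinearMap.restrictScalars
      ℚ).compLinearMap fun _ => LinearMap.pi fun i : Fin q => ζ i
  map_eq_zero_of_eq' v i j hij hne :=
    (Matrix.detRowAlternating (n := Fin q) (R := S)).map_eq_zero_of_eq
      (fun j => LinearMap.pi (fun i : Fin q => ζ i) (v j)) (by simp [hij]) hne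

theorem detForm_apply (q : ℕ) (ζ : ℕ → V →ₗ[ℚ] S) (v : Fin q → V) :
    detForm q ζ v = Matrix.det (Matrix.of fun i j : Fin q => ζ i (v j)) := by
  rw [← Matrix.det_transpose]
  rfl

/-- The linear extension to the exterior algebra of `v_1 ∧ ⋯ ∧ v_q ↦ det (ζ_i (v_j))`, zero in
degrees other than `q`. -/
def detLinear (q : ℕ) (ζ : ℕ → V →ₗ[ℚ] S) : ExteriorAlgebra ℚ V →ₗ[ℚ] S :=
  ExteriorAlgebra.liftAlternating (Pi.single q (detForm q ζ))

theorem detLinear_ιMulti (q : ℕ) (ζ : ℕ → V →ₗ[ℚ] S) (v : Fin q → V) :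
    detLinear q ζ (ExteriorAlgebra.ιMulti ℚ q v) =
      Matrix.det (Matrix.of fun i j : Fin q => ζ i (v j)) := by
  rw [detLinear, ExteriorAlgebra.liftAlternating_apply_ιMulti, Pi.single_eq_same, detForm_apply]

/-- The antiderivation rule unrolled. The signs are those of a cofactor expansion along the top row.
-/
theorem contractLeft_ιMulti (d : Module.Dual ℚ V) (n : ℕ) (v : Fin (n + 1) → V) :
    CliffordAlgebra.contractLeft (Q := (0 : QuadraticForm ℚ V)) d
      (ExteriorAlgebra.ιMulti ℚ (n + 1) v) =
      ∑ l : Fin (n + 1), ((-1) ^ (l : ℕ) * d (v l)) •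
        ExteriorAlgebra.ιMulti ℚ n fun i => v (l.succAbove i) := by
  induction n with
  | zero =>
    rw [ExteriorAlgebra.ιMulti_succ_apply, ExteriorAlgebra.ιMulti_zero_apply, mul_one]
    refine (CliffordAlgebra.contractLeft_ι (Q := (0 : QuadraticForm ℚ V)) d (v 0)).trans ?_
    simp [ExteriorAlgebra.ιMulti_zero_apply, Algebra.algebraMap_eq_smul_one]
  | succ n ih =>
    rw [ExteriorAlgebra.ιMulti_succ_apply]
    refine (CliffordAlgebra.contractLeft_ι_mul (Q := (0 : QuadraticForm ℚ V)) d (v 0) _).trans ?_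
    have h1 := ih (Matrix.vecTail v)
    rw [Fin.sum_univ_succ, sub_eq_add_neg]
    congr 1
    · simp [Matrix.vecTail, Function.comp_def]
    · refine (congrArg (fun x => -(ExteriorAlgebra.ι ℚ (v 0) * x)) h1).trans ?_
      rw [Finset.mul_sum, ← Finset.sum_neg_distrib]
      refine Finset.sum_congr rfl fun l _ => ?_
      rw [mul_smul_comm, ← neg_smul, ExteriorAlgebra.ιMulti_succ_apply]
      congr 1
      · simp [Matrix.vecTail, pow_succ]
      · congr 2
        simp [Matrix.vecTail, Function.comp_def]

/-- Iterated Laplace expansion. The leftmost form of `d_0 ∧ d_1 ∧ ⋯` is contracted first, so each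
step of the induction expands along row zero and shifts the remaining rows up by one. -/
theorem detLinear_contract (k q n : ℕ) (hn : n = k + q) (d : Fin k → Module.Dual ℚ V)
    (ζ : ℕ → V →ₗ[ℚ] S) (hζ : ∀ (i : Fin k) (x : V), ζ i x = algebraMap ℚ S (d i x))
    (v : Fin n → V) :
    detLinear q (fun i => ζ (k + i)) ((contract (ExteriorAlgebra.ιMulti ℚ k d)).unop
      (ExteriorAlgebra.ιMulti ℚ n v)) =
      Matrix.det (Matrix.of fun i j : Fin n => ζ i (v j)) := by
  induction k generalizing n ζ with
  | zero =>
    obtain rfl : n = q := by omega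
    simp [ExteriorAlgebra.ιMulti_zero_apply, detLinear_ιMulti]
  | succ k ih =>
    obtain ⟨n, rfl⟩ : ∃ m, n = m + 1 := ⟨k + q, by omega⟩
    rw [ExteriorAlgebra.ιMulti_succ_apply, contract_ι_mul, contractLeft_ιMulti, map_sum, map_sum,
      Matrix.det_succ_row_zero]
    refine Finset.sum_congr rfl fun l _ => ?_
    have h1 := ih n (by omega) (Matrix.vecTail d) (fun i => ζ (i + 1))
      (fun i x => by simpa [Matrix.vecTail] using hζ i.succ x) (fun i => v (l.succAbove i))
    have h2 : (fun i => ζ (k + 1 + i)) = fun i => ζ (k + i + 1) := by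
      ext1 i
      congr 1
      omega
    rw [map_smul, map_smul, h2, h1, Algebra.smul_def, map_mul, Matrix.of_apply]
    have h3 := hζ 0 (v l)
    simp only [Fin.val_zero] at h3 ⊢
    rw [h3]
    simp [Matrix.submatrix, mul_assoc]

end detForm

/-- The linear form `b_m ↦ h_{m-r+1+i}`. -/
def hForm (r : ℕ) (i : ℕ) : V →ₗ[ℚ] B r :=
  Finsupp.linearCombination ℚ fun m => h r ((m : ℤ) - r + 1 + i)

theorem hForm_b (r i m : ℕ) : hForm r i (b m) = h r ((m : ℤ) - r + 1 + i) := by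
  simp [hForm, b]

theorem column_apply (r : ℕ) (v : V) (i : Fin r) : column r v i = hForm r i v := by
  have : LinearMap.proj i ∘ₗ column r = hForm r i := by
    ext m
    simp [column, hForm]
  exact LinearMap.congr_fun this v

theorem toBoson_eq_detLinear (r : ℕ) (u : ⋀[ℚ]^r V) :
    toBoson r u = detLinear r (hForm r) (u : ExteriorAlgebra ℚ V) := by
  have : toBoson r = detLinear r (hForm r) ∘ₗ (⋀[ℚ]^r V).subtype := by
    apply exteriorPower.linearMap_ext
    refine AlternatingMap.ext fun v => ?_
    simp only [LinearMap.compAlternatingMap_apply, LinearMap.comp_apply, Submodule.subtype_apply,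
      exteriorPower.ιMulti_apply_coe]
    rw [detLinear_ιMulti, toBoson, exteriorPower.alternatingMapLinearEquiv_apply_ιMulti,
      columnDet_apply, ← Matrix.det_transpose]
    exact congrArg Matrix.det (Matrix.ext fun i j => column_apply r (v j) i)
  exact LinearMap.congr_fun this u

/-! ### The operators `σ̄_-` on the `h_j` -/

theorem shift_b (m : ℕ) : shift (b m) = if m = 0 then 0 else b (m - 1) := by
  simp [shift, b]

/-- `b_{n-1} ∧ ⋯ ∧ b_0`. -/
def vacuum (n : ℕ) : ExteriorAlgebra ℚ V :=
  ExteriorAlgebra.ιMulti ℚ n fun i => b (n - 1 - i)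

theorem vacuum_succ (n : ℕ) : vacuum (n + 1) = ExteriorAlgebra.ι ℚ (b n) * vacuum n := by
  rw [vacuum, ExteriorAlgebra.ιMulti_succ_apply, vacuum]
  congr 2
  ext1 i
  simp only [Matrix.vecTail, Function.comp_apply, Fin.val_succ]
  congr 1
  omega

/-- The shift of `b_n` is `b_{n-1}`, already a factor of the vacuum, or zero when `n = 0`. Hence
`σ̄_-` fixes the vacuum. -/
theorem ι_shift_mul_vacuum (n : ℕ) :
    ExteriorAlgebra.ι ℚ (shift (b n)) * vacuum n = 0 := by
  cases n with
  | zero => simp [shift_b]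
  | succ n =>
    rw [vacuum_succ, ← mul_assoc, shift_b]
    simp

theorem sigmaBar_vacuum (n : ℕ) : sigmaBar (vacuum n) = Polynomial.C (vacuum n) := by
  induction n with
  | zero => simp [vacuum, ExteriorAlgebra.ιMulti_zero_apply]
  | succ n ih =>
    rw [vacuum_succ, map_mul, ih, sigmaBar_ι, sub_mul, ← Polynomial.monomial_zero_left,
      Polynomial.monomial_mul_monomial, Polynomial.monomial_mul_monomial, ι_shift_mul_vacuum]
    simp

theorem sigmaBarCoeff_ι_mul_vacuum (n i : ℕ) (v : V) :
    sigmaBarCoeff i (ExteriorAlgebra.ι ℚ v * vacuum n) =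
      if i = 0 then ExteriorAlgebra.ι ℚ v * vacuum n
      else if i = 1 then -(ExteriorAlgebra.ι ℚ (shift v) * vacuum n) else 0 := by
  simp only [sigmaBarCoeff, LinearMap.comp_apply, AlgHom.toLinearMap_apply, map_mul,
    sigmaBar_ι, sigmaBar_vacuum, sub_mul, LinearMap.restrictScalars_apply, Polynomial.lcoeff_apply,
    ← Polynomial.monomial_zero_left, Polynomial.monomial_mul_monomial, Polynomial.coeff_sub,
    Polynomial.coeff_monomial]
  rcases i with _ | _ | i <;> simp

theorem ι_mul_vacuum_mem (n : ℕ) (v : V) :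
    ExteriorAlgebra.ι ℚ v * vacuum n ∈ ⋀[ℚ]^(n + 1) V := by
  have := ExteriorAlgebra.ιMulti_range ℚ (M := V) (n + 1)
    (Set.mem_range_self (Matrix.vecCons v fun i : Fin n => b (n - 1 - i)))
  rwa [ExteriorAlgebra.ιMulti_succ_apply] at this

/-- This is the Giambelli determinant of a one-row partition: the matrix is lower triangular with
diagonal `h_j, 1, …, 1`. -/
theorem detLinear_ι_mul_vacuum (n j : ℕ) :
    detLinear (n + 1) (hForm (n + 1)) (ExteriorAlgebra.ι ℚ (b (n + j)) * vacuum n) =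
      h (n + 1) j := by
  have h1 : ExteriorAlgebra.ι ℚ (b (n + j)) * vacuum n = ExteriorAlgebra.ιMulti ℚ (n + 1)
        fun c => b ((Fin.cons (n + j) fun i : Fin n => n - 1 - i : Fin (n + 1) → ℕ) c) := by
    rw [ExteriorAlgebra.ιMulti_succ_apply]
    rfl
  rw [h1, detLinear_ιMulti, Matrix.det_of_isLowerTriangular]
  · rw [Fin.prod_univ_succ, Finset.prod_eq_one, mul_one]
    · simp [hForm_b]
    · intro i _
      rw [Matrix.of_apply, Fin.cons_succ, hForm_b, ← h_zero (n + 1), Fin.val_succ]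
      congr 1
      have := i.2
      omega
  · intro i c hic
    have hic : i < c := hic
    rw [Matrix.of_apply, hForm_b]
    apply h_neg
    obtain ⟨c, rfl⟩ := Fin.exists_succ_eq.2 (Fin.ne_zero_of_lt hic)
    rw [Fin.cons_succ]
    have := c.2
    have : (i : ℕ) < c + 1 := hic
    omega

theorem sigmaBarBoson_detLinear (r i : ℕ) (u : ExteriorAlgebra ℚ V) (hu : u ∈ ⋀[ℚ]^r V) :
    sigmaBarBoson r i (detLinear r (hForm r) u) =
      detLinear r (hForm r) (sigmaBarCoeff i u) := by
  have h1 : detLinear r (hForm r) u = boson r ⟨u, hu⟩ :=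
    (toBoson_eq_detLinear r ⟨u, hu⟩).symm
  rw [h1, sigmaBarBoson, LinearMap.comp_apply, LinearMap.comp_apply]
  simp only [LinearEquiv.coe_coe, LinearEquiv.symm_apply_apply]
  exact toBoson_eq_detLinear r _

theorem sigmaBarBoson_h (n i : ℕ) (j : ℤ) :
    sigmaBarBoson (n + 1) i (h (n + 1) j) =
      if i = 0 then h (n + 1) j else if i = 1 then -h (n + 1) (j - 1) else 0 := by
  rcases lt_or_ge j 0 with hj | hj
  · simp [h_neg _ j hj, h_neg _ (j - 1) (by omega)]
  lift j to ℕ using hj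
  rw [← detLinear_ι_mul_vacuum, sigmaBarBoson_detLinear _ _ _ (ι_mul_vacuum_mem _ _),
    sigmaBarCoeff_ι_mul_vacuum]
  split_ifs
  · rfl
  · rw [map_neg]
    congr 1
    cases j with
    | zero =>
      -- For `j = 0` the shifted vector repeats a factor of the vacuum, in agreement with `h_{-1} =
      -- 0`.
      rw [h_neg _ _ (by simp), add_zero, ι_shift_mul_vacuum, map_zero]
    | succ j =>
      have h2 : ((j + 1 : ℕ) : ℤ) - 1 = j := by simp
      rw [h2, ← detLinear_ι_mul_vacuum, shift_b, if_neg (by omega)]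
      rfl
  · exact map_zero _

/-- The last operator of the list acts first and turns `h_j` into `h_j - y h_{j-1}`; the induction
hypothesis applies to both terms. The `y_c` lie in an arbitrary algebra because the field `K r k`
changes with `k`. -/
theorem sum_sigmaBarBoson_h {K : Type*} [CommRing K] (n k : ℕ) [Algebra (B (n + 1)) K]
    (y : Fin k → K) (j : ℤ) :
    ∑ i : Fin k → Fin (n + 2),
      algebraMap (B (n + 1)) K
        ((List.ofFn fun c => sigmaBarBoson (n + 1) (i c)).prod (h (n + 1) j)) *
          ∏ c, y c ^ (i c : ℕ) =
      ∑ s ∈ Finset.range (k + 1),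
        (linearProd y).coeff s * algebraMap (B (n + 1)) K (h (n + 1) (j - s)) := by
  induction k generalizing j with
  | zero => simp [linearProd]
  | succ k ih =>
    -- The index of the innermost operator is split off; only its values 0 and 1 contribute.
    rw [← (Fin.snocEquiv fun _ : Fin (k + 1) => Fin (n + 2)).sum_comp, Fintype.sum_prod_type,
      Fin.sum_univ_succ, Fin.sum_univ_succ]
    simp only [Fin.snocEquiv_apply, List.ofFn_succ', Fin.snoc_castSucc, Fin.snoc_last,
      List.concat_eq_append, List.prod_append, List.prod_singleton, Module.End.mul_apply,
      Fin.prod_univ_castSucc, sigmaBarBoson_h]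
    simp only [Fin.val_zero, Fin.val_succ, if_true, zero_add, one_ne_zero, if_false, pow_zero,
      mul_one, pow_one, Nat.add_eq_right, Nat.succ_ne_zero, map_zero, zero_mul,
      Finset.sum_const_zero, add_zero, map_neg, neg_mul, Finset.sum_neg_distrib]
    have h1 := ih (fun c => y c.castSucc) j
    have h2 := ih (fun c => y c.castSucc) (j - 1)
    simp only [← mul_assoc, ← Finset.sum_mul]
    rw [h1, h2, Finset.sum_range_succ' _ (k + 1)]
    simp only [linearProd_snoc, sub_mul, Finset.sum_sub_distrib]
    rw [Finset.sum_range_succ (fun x => _ * algebraMap (B (n + 1)) K (h (n + 1) (j - ↑(x + 1)))) k,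
      linearProd_coeff_of_lt (fun c : Fin k => y c.castSucc) (Nat.lt_succ_self k), zero_mul,
      add_zero, Finset.sum_range_succ' _ k, linearProd_coeff_zero, linearProd_coeff_zero,
      Finset.sum_mul]
    have h3 : ∀ s : ℕ, j - 1 - (s : ℤ) = j - ((s + 1 : ℕ) : ℤ) := fun s => by push_cast; ring
    simp only [h3]
    simp only [mul_comm _ (y (Fin.last k)), mul_assoc]
    abel

theorem sigmaBarMulti_h (r k : ℕ) (hk : k ≤ r) (j : ℤ) :
    sigmaBarMulti r k (h r j) = ∑ s ∈ Finset.range (k + 1),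
      (linearProd fun a => (z r k a)⁻¹).coeff s * algebraMap (B r) (K r k) (h r (j - s)) := by
  -- Rank zero is separate: there `h_1 = 0` but `h_0 = 1`, so `σ̄_-(z) h_1 = h_1 - z⁻¹ h_0` fails.
  -- But then `k = 0` and no operator acts.
  cases r with
  | zero =>
    obtain rfl : k = 0 := by omega
    simp [sigmaBarMulti, linearProd]
  | succ n => exact sum_sigmaBarBoson_h n k (fun a => (z (n + 1) k a)⁻¹) j

theorem action_boson (r k : ℕ) (m n : Part k) (u : ⋀[ℚ]^r V) :
    action r k m n (boson r u) = detLinear r (hForm r) ((wedge k m : ExteriorAlgebra ℚ V) *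
      (contract (wedgeBeta k n)).unop (u : ExteriorAlgebra ℚ V)) := by
  rw [action, LinearMap.comp_apply, LinearMap.comp_apply]
  simp only [LinearEquiv.coe_coe, LinearEquiv.symm_apply_apply]
  exact toBoson_eq_detLinear r _

/-! ### Alternants and strictly decreasing exponents -/

/-- The strictly decreasing sequence `(k-1+μ_1, …, μ_k)`. -/
def exponents (k : ℕ) (m : Part k) : Fin k → ℕ := fun j => k - 1 - j + m j

theorem exponents_strictAnti (k : ℕ) (m : Part k) : StrictAnti (exponents k m) := by
  intro i j hij
  have h1 : m j ≤ m i := m.2 hij.le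
  have h2 : (i : ℕ) < j := hij
  have h3 := j.2
  simp only [exponents]
  omega

theorem exponents_injective (k : ℕ) : Function.Injective (exponents k) := by
  intro m n hmn
  apply Subtype.ext
  ext1 j
  exact Nat.add_left_cancel (congrFun hmn j)

theorem sub_le_of_strictAnti {k : ℕ} {f : Fin k → ℕ} (hf : StrictAnti f) (j : Fin k) :
    k - 1 - j ≤ f j := by
  obtain ⟨t, ht⟩ : ∃ t, t = k - 1 - (j : ℕ) := ⟨_, rfl⟩
  induction t generalizing j with
  | zero => omega
  | succ t ih =>
    have h1 := ih ⟨j + 1, by omega⟩ (by simp; omega)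
    have h2 : f ⟨j + 1, by omega⟩ < f j := hf (Nat.lt_succ_self (j : ℕ))
    simp only at h1
    omega

theorem exists_exponents_eq {k : ℕ} {f : Fin k → ℕ} (hf : StrictAnti f) :
    ∃ m : Part k, exponents k m = f := by
  have h0 := sub_le_of_strictAnti hf
  refine ⟨⟨fun j => f j - (k - 1 - j), antitone_iff_forall_lt.2 fun i j hij => ?_⟩, ?_⟩
  · have h1 : ∀ (t : ℕ) (j : Fin k), (j : ℕ) = i + t → f j + t ≤ f i := by
      intro t
      induction t with
      | zero => intro j hj; rw [Fin.ext (a := j) (b := i) hj]; exact le_rfl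
      | succ t ih =>
        intro j hj
        have h2 := ih ⟨i + t, by omega⟩ rfl
        have h3 : f j < f ⟨i + t, by omega⟩ := hf (Fin.lt_def.2 (by simp only; omega))
        omega
    have h2 : (i : ℕ) < j := hij
    have h3 := h1 (j - i) j (by omega)
    have h4 := h0 i
    have h5 := h0 j
    have h6 := j.2
    omega
  · ext1 j
    exact Nat.add_sub_cancel' (h0 j)

/-- Sort the values increasingly, then reverse. -/
theorem exists_perm_exponents {k : ℕ} {f : Fin k → ℕ} (hf : Function.Injective f) :
    ∃ (s : Equiv.Perm (Fin k)) (m : Part k), f ∘ s = exponents k m := by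
  have h1 : StrictMono (f ∘ Tuple.sort f) :=
    (Tuple.monotone_sort f).strictMono_of_injective (hf.comp (Tuple.sort f).injective)
  have h2 : StrictAnti (f ∘ (Fin.revPerm.trans (Tuple.sort f))) := by
    intro i j hij
    exact h1 (Fin.rev_lt_rev.2 hij)
  obtain ⟨m, hm⟩ := exists_exponents_eq h2
  exact ⟨_, m, hm.symm⟩

theorem coeff_alternant (k : ℕ) (m : Fin k → ℕ) (d : Fin k →₀ ℕ) :
    MvPolynomial.coeff d (alternant k m) =
      ∑ s : Equiv.Perm (Fin k), if ⇑d ∘ s = m then ((Equiv.Perm.sign s : ℤ) : ℚ) else 0 := by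
  rw [alternant, Matrix.det_apply, MvPolynomial.coeff_sum]
  refine Finset.sum_congr rfl fun s _ => ?_
  simp only [Matrix.of_apply]
  have h1 : (Finsupp.equivFunOnFinite.symm (m ∘ s.symm) = d) ↔ ⇑d ∘ s = m := by
    constructor
    · rintro rfl
      ext j
      simp
    · rintro rfl
      ext j
      simp
  rw [prod_X_eq, Units.smul_def, ← Int.cast_smul_eq_zsmul ℚ, MvPolynomial.coeff_smul,
    MvPolynomial.coeff_monomial]
  simp only [h1]
  split_ifs <;> simp

-- Distinct exponents are put in decreasing order by exactly one permutation, so a given monomial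
-- occurs in the alternant of only one partition, with the sign of that permutation.
open scoped Classical in
theorem coeff_alternant_exponents {k : ℕ} (d : Fin k →₀ ℕ) (s : Equiv.Perm (Fin k)) (m : Part k)
    (hs : ⇑d ∘ s = exponents k m) (n : Part k) :
    MvPolynomial.coeff d (alternant k (exponents k n)) =
      if n = m then ((Equiv.Perm.sign s : ℤ) : ℚ) else 0 := by
  have h1 : ∀ t : Equiv.Perm (Fin k), ⇑d ∘ t = exponents k n ↔ n = m ∧ t = s := by
    intro t
    constructor
    · intro ht
      have h2 : exponents k n = exponents k m := by
        rw [← ht, ← hs]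
        apply Tuple.unique_antitone
        · rw [ht]; exact (exponents_strictAnti k n).antitone
        · rw [hs]; exact (exponents_strictAnti k m).antitone
      refine ⟨exponents_injective k h2, Equiv.ext fun i => ?_⟩
      have hd : Function.Injective (⇑d ∘ s) := by
        rw [hs]; exact (exponents_strictAnti k m).injective
      have hd' : Function.Injective d := (EquivLike.injective_comp s _).1 hd
      apply hd'
      exact congrFun (ht.trans (h2.trans hs.symm)) i
    · rintro ⟨rfl, rfl⟩
      exact hs
  rw [coeff_alternant]
  simp only [h1]
  by_cases hn : n = m <;> simp [hn]

/-- If `d` has distinct entries, one partition contributes, and its sorting sign cancels the sign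
from reordering the arguments of `f`. If `d` has a repetition, both sides vanish. -/
theorem sum_coeff_alternant {k : ℕ} {M N : Type*} [AddCommGroup M] [Module ℚ M] [AddCommGroup N]
    [Module ℚ N] (f : M [⋀^Fin k]→ₗ[ℚ] N) (c : ℕ → M) (d : Fin k →₀ ℕ) (T : Finset (Part k))
    (hT : ∀ m : Part k, ∑ i, m i ≤ ∑ i, d i → m ∈ T) :
    ∑ m ∈ T, MvPolynomial.coeff d (alternant k (exponents k m)) • f (fun j => c (exponents k m j)) =
      f fun j => c (d j) := by
  classical
  by_cases hd : Function.Injective d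
  · obtain ⟨s, m, hs⟩ := exists_perm_exponents hd
    simp only [coeff_alternant_exponents d s m hs, ite_smul, zero_smul]
    rw [Finset.sum_ite_eq', if_pos]
    · rw [← hs]
      have h1 := f.map_perm (fun j => c (d j)) s
      change f (fun j => c ((⇑d ∘ s) j)) = _ at h1
      rw [h1, Units.smul_def, ← Int.cast_smul_eq_zsmul ℚ, smul_smul, ← Int.cast_mul,
        ← Units.val_mul, Int.units_mul_self]
      simp
    · apply hT
      -- The sorted exponents dominate the parts of `m`, so `|m| ≤ ∑ d_i` and `m` lies in `T`.
      rw [← Equiv.sum_comp s d]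
      refine Finset.sum_le_sum fun i _ => ?_
      have := congrFun hs i
      simp only [exponents, Function.comp_apply] at this
      omega
  · have h1 : f (fun j => c (d j)) = 0 := by
      obtain ⟨i, j, hij, hne⟩ := by simpa [Function.Injective] using hd
      exact f.map_eq_zero_of_eq _ (by simp [hij]) hne
    rw [h1]
    refine Finset.sum_eq_zero fun m _ => ?_
    rw [coeff_alternant, Finset.sum_eq_zero, zero_smul]
    intro s _
    rw [if_neg]
    intro hs
    apply hd
    have h2 : Function.Injective (⇑d ∘ s) := by
      rw [hs]; exact (exponents_strictAnti k m).injective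
    exact (EquivLike.injective_comp s _).1 h2

/-! ### Homogeneity of alternants and Schur polynomials -/

theorem alternating_eq_alternant (k : ℕ) (m : Part k) : alternating k m =
    Equiv.Perm.sign (Fin.revPerm (n := k)) • alternant k (exponents k m) := by
  rw [alternating_eq, alternant_eq]
  rfl

theorem alternating_isHomogeneous (k : ℕ) (m : Part k) :
    (alternating k m).IsHomogeneous (∑ i : Fin k, (m i.rev + i)) := by
  rw [alternating, Matrix.det_apply]
  refine MvPolynomial.IsHomogeneous.sum _ _ _ fun s _ => ?_
  simp only [Matrix.of_apply, Units.smul_def, ← Int.cast_smul_eq_zsmul ℚ,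
    MvPolynomial.smul_eq_C_mul]
  refine MvPolynomial.IsHomogeneous.C_mul ?_ _
  rw [← Equiv.sum_comp s]
  exact MvPolynomial.IsHomogeneous.prod _ _ _ fun i _ => MvPolynomial.isHomogeneous_X_pow _ _

theorem weight_one_eq_degree {σ : Type*} (d : σ →₀ ℕ) :
    Finsupp.weight (1 : σ → ℕ) d = d.degree := by
  rw [Finsupp.degree_eq_weight_one]
  rfl

-- A component of `s_μ` in a wrong degree, multiplied by the homogeneous `Δ_0`, would be a component
-- of the homogeneous `Δ_μ` in a wrong degree, hence zero; and `Δ_0 ≠ 0` in a domain.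
attribute [local instance] MvPolynomial.gradedAlgebra in
theorem schur_isHomogeneous (k : ℕ) (m : Part k) :
    (schur k m).IsHomogeneous (∑ i : Fin k, m i) := by
  have h1 : ∑ i : Fin k, (m i.rev + i) = ∑ i : Fin k, m i + ∑ i : Fin k, ((zeroPart k) i.rev + i) := by
    rw [Finset.sum_add_distrib]
    congr 1
    · exact Equiv.sum_comp Fin.revPerm fun i => m i
    · simp [zeroPart]
  have h2 := alternating_isHomogeneous k m
  have h0 := alternating_isHomogeneous k (zeroPart k)
  rw [h1] at h2
  intro d hd
  by_contra hne
  have h3 := DirectSum.coe_decompose_mul_add_of_right_mem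
    (MvPolynomial.homogeneousSubmodule (Fin k) ℚ) (a := schur k m) (i := d.degree)
    ((MvPolynomial.mem_homogeneousSubmodule _ _).2 h0)
  rw [← schur_mul_alternating, DirectSum.decompose_of_mem_ne
    (MvPolynomial.homogeneousSubmodule (Fin k) ℚ) ((MvPolynomial.mem_homogeneousSubmodule _ _).2 h2)]
    at h3
  · have h4 := (mul_eq_zero.1 h3.symm).resolve_right (alternating_zero_ne_zero k)
    have h5 : MvPolynomial.homogeneousComponent d.degree (schur k m) = 0 :=
      (MvPolynomial.decomposition.decompose'_apply _ _).symm.trans h4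
    have h6 := congrArg (MvPolynomial.coeff d) h5
    rw [MvPolynomial.coeff_homogeneousComponent, if_pos rfl] at h6
    exact hd h6
  · intro h
    apply hne
    rw [weight_one_eq_degree]
    exact (Nat.add_right_cancel h).symm

/-! ### The coefficients of the generating function -/

/-- The partitions of length at most `k` with parts at most `n`. -/
def partsLE (k n : ℕ) : Finset (Part k) :=
  Set.Finite.toFinset (s := {m : Part k | ∀ i, m i ≤ n})
    ((Set.finite_Iic (fun _ : Fin k => n)).preimage Subtype.val_injective.injOn)

theorem mem_partsLE_of_sum_le {k n : ℕ} {m : Part k} (hm : ∑ i, m i ≤ n) : m ∈ partsLE k n := by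
  refine (Set.Finite.mem_toFinset _).2 fun i => ?_
  exact (Finset.single_le_sum (fun j _ => Nat.zero_le (m j)) (Finset.mem_univ i)).trans hm

/-- The exponents of the variables `Sum.inl j`. -/
def leftExp {k : ℕ} (d : Fin k ⊕ Fin k →₀ ℕ) : Fin k →₀ ℕ :=
  d.comapDomain Sum.inl Sum.inl_injective.injOn

/-- The exponents of the variables `Sum.inr j`. -/
def rightExp {k : ℕ} (d : Fin k ⊕ Fin k →₀ ℕ) : Fin k →₀ ℕ :=
  d.comapDomain Sum.inr Sum.inr_injective.injOn

@[simp] theorem leftExp_apply {k : ℕ} (d : Fin k ⊕ Fin k →₀ ℕ) (j : Fin k) :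
    leftExp d j = d (Sum.inl j) := rfl

@[simp] theorem rightExp_apply {k : ℕ} (d : Fin k ⊕ Fin k →₀ ℕ) (j : Fin k) :
    rightExp d j = d (Sum.inr j) := rfl

theorem coeff_rename_mul_rename {k : ℕ} (p q : MvPolynomial (Fin k) ℚ) (d : Fin k ⊕ Fin k →₀ ℕ) :
    MvPolynomial.coeff d (MvPolynomial.rename Sum.inl p * MvPolynomial.rename Sum.inr q) =
      MvPolynomial.coeff (leftExp d) p * MvPolynomial.coeff (rightExp d) q := by
  induction p using MvPolynomial.induction_on' with
  | add p p' hp hp' => rw [map_add, add_mul, MvPolynomial.coeff_add, hp, hp',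
      MvPolynomial.coeff_add, add_mul]
  | monomial a x =>
    induction q using MvPolynomial.induction_on' with
    | add q q' hq hq' => rw [map_add, mul_add, MvPolynomial.coeff_add, hq, hq',
        MvPolynomial.coeff_add, mul_add]
    | monomial c y =>
      have h1 : Finsupp.mapDomain Sum.inl a + Finsupp.mapDomain Sum.inr c = d ↔
          a = leftExp d ∧ c = rightExp d := by
        constructor
        · rintro rfl
          constructor
          · ext j
            simp [Finsupp.mapDomain_apply Sum.inl_injective, Finsupp.mapDomain_of_notMem_range]
          · ext j
            simp [Finsupp.mapDomain_apply Sum.inr_injective, Finsupp.mapDomain_of_notMem_range]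
        · rintro ⟨rfl, rfl⟩
          ext (j | j)
          · simp [Finsupp.mapDomain_apply Sum.inl_injective, Finsupp.mapDomain_of_notMem_range]
          · simp [Finsupp.mapDomain_apply Sum.inr_injective, Finsupp.mapDomain_of_notMem_range]
      rw [MvPolynomial.rename_monomial, MvPolynomial.rename_monomial, MvPolynomial.monomial_mul,
        MvPolynomial.coeff_monomial, MvPolynomial.coeff_monomial, MvPolynomial.coeff_monomial]
      simp only [h1]
      by_cases ha : a = leftExp d <;> by_cases hc : c = rightExp d <;> simp [ha, hc]

theorem coeff_schur_ne_zero {k : ℕ} {m n : Part k} {d : Fin k ⊕ Fin k →₀ ℕ}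
    (hd : MvPolynomial.coeff d (MvPolynomial.rename Sum.inl (schur k m) *
      MvPolynomial.rename Sum.inr (schur k n)) ≠ 0) :
    ∑ i, m i = ∑ i, leftExp d i ∧ ∑ i, n i = ∑ i, rightExp d i := by
  rw [coeff_rename_mul_rename] at hd
  have h1 := schur_isHomogeneous k m (left_ne_zero_of_mul hd)
  have h2 := schur_isHomogeneous k n (right_ne_zero_of_mul hd)
  rw [weight_one_eq_degree, Finsupp.degree_eq_sum] at h1 h2
  exact ⟨h1.symm, h2.symm⟩

/-- By homogeneity one finite index set serves all monomials of degree at most `N`. This uniformity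
allows sums to be exchanged in the Cauchy product with a polynomial. -/
theorem coeff_generating (r k N : ℕ) (f : B r) (d : Fin k ⊕ Fin k →₀ ℕ) (hd : d.degree ≤ N) :
    MvPowerSeries.coeff d (generating r k f) =
      ∑ p ∈ partsLE k N ×ˢ partsLE k N,
        MvPolynomial.coeff d (MvPolynomial.rename Sum.inl (schur k p.1) *
          MvPolynomial.rename Sum.inr (schur k p.2)) • action r k p.1 p.2 f := by
  refine (finsum_eq_sum_of_support_subset _ fun p hp => ?_)
  have h1 := coeff_schur_ne_zero (left_ne_zero_of_smul hp)
  rw [Finsupp.degree_eq_sum, Fintype.sum_sum_type] at hd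
  simp only [leftExp_apply, rightExp_apply] at h1
  exact Finset.mem_coe.2 (Finset.mem_product.2
    ⟨mem_partsLE_of_sum_le (by omega), mem_partsLE_of_sum_le (by omega)⟩)

/-! ### Multiplication by the Vandermonde determinants -/

/-- A polynomial with rational coefficients, as a power series over `B_r`. -/
def toSeries (r : ℕ) {σ : Type*} (p : MvPolynomial σ ℚ) : MvPowerSeries σ (B r) :=
  (MvPolynomial.map (algebraMap ℚ (B r)) p : MvPolynomial σ (B r))

theorem coeff_toSeries_mul_generating (r k N : ℕ) (f : B r) (q : MvPolynomial (Fin k ⊕ Fin k) ℚ)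
    (d : Fin k ⊕ Fin k →₀ ℕ) (hd : d.degree ≤ N) :
    MvPowerSeries.coeff d (toSeries r q * generating r k f) =
      ∑ p ∈ partsLE k N ×ˢ partsLE k N,
        MvPolynomial.coeff d (q * (MvPolynomial.rename Sum.inl (schur k p.1) *
          MvPolynomial.rename Sum.inr (schur k p.2))) • action r k p.1 p.2 f := by
  classical
  rw [MvPowerSeries.coeff_mul]
  simp only [MvPolynomial.coeff_mul q, Finset.sum_smul]
  rw [Finset.sum_comm]
  refine Finset.sum_congr rfl fun c hc => ?_
  rw [Finset.HasAntidiagonal.mem_antidiagonal] at hc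
  have h1 : c.2.degree ≤ N := by
    rw [← hc, map_add] at hd
    omega
  rw [coeff_generating r k N f c.2 h1, Finset.mul_sum, toSeries, MvPolynomial.coeff_coe,
    MvPolynomial.coeff_map]
  refine Finset.sum_congr rfl fun p _ => ?_
  rw [mul_smul, ← Algebra.smul_def]

/-- The product of the Vandermonde determinants in the `z_j` and in the `w_j⁻¹`. -/
def vandermondes (k : ℕ) : MvPolynomial (Fin k ⊕ Fin k) ℚ :=
  MvPolynomial.rename Sum.inl (alternating k (zeroPart k)) *
    MvPolynomial.rename Sum.inr (alternating k (zeroPart k))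

/-- The sign of the reversal relating `alternating` to `alternant` occurs once for `z` and once for
`w⁻¹`, and cancels. -/
theorem vandermondes_mul_schur (k : ℕ) (m n : Part k) :
    vandermondes k * (MvPolynomial.rename Sum.inl (schur k m) *
      MvPolynomial.rename Sum.inr (schur k n)) =
    MvPolynomial.rename Sum.inl (alternant k (exponents k m)) *
      MvPolynomial.rename Sum.inr (alternant k (exponents k n)) := by
  have h1 : vandermondes k * (MvPolynomial.rename Sum.inl (schur k m) *
      MvPolynomial.rename Sum.inr (schur k n)) = MvPolynomial.rename Sum.inl (alternating k m) *
      MvPolynomial.rename Sum.inr (alternating k n) := by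
    rw [schur_mul_alternating k m, schur_mul_alternating k n, map_mul, map_mul, vandermondes]
    ring
  rw [h1, alternating_eq_alternant, alternating_eq_alternant]
  simp only [Units.smul_def, zsmul_eq_mul, map_mul, map_intCast]
  rw [mul_mul_mul_comm, ← Int.cast_mul, ← Units.val_mul, Int.units_mul_self]
  simp

/-- `sum_coeff_alternant` is used twice: over `μ`, for the wedge product as an alternating function
of vectors, then over `ν`, for the contraction as an alternating function of forms. -/
theorem coeff_vandermondes_mul_generating (r k : ℕ) (u : ⋀[ℚ]^r V) (d : Fin k ⊕ Fin k →₀ ℕ) :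
    MvPowerSeries.coeff d (toSeries r (vandermondes k) * generating r k (boson r u)) =
      detLinear r (hForm r) (ExteriorAlgebra.ιMulti ℚ k (fun j => b (leftExp d j)) *
        (contract (ExteriorAlgebra.ιMulti ℚ k fun j => beta (rightExp d j))).unop
          (u : ExteriorAlgebra ℚ V)) := by
  have hd : ∑ i, leftExp d i + ∑ i, rightExp d i ≤ d.degree := by
    rw [Finsupp.degree_eq_sum, Fintype.sum_sum_type]
    rfl
  rw [coeff_toSeries_mul_generating r k d.degree _ _ d le_rfl]
  simp only [vandermondes_mul_schur, coeff_rename_mul_rename]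
  rw [Finset.sum_product_right]
  have h1 : ∀ n : Part k, ∑ m ∈ partsLE k d.degree,
      (MvPolynomial.coeff (leftExp d) (alternant k (exponents k m)) *
        MvPolynomial.coeff (rightExp d) (alternant k (exponents k n))) •
          action r k m n (boson r u) =
      MvPolynomial.coeff (rightExp d) (alternant k (exponents k n)) •
        detLinear r (hForm r) (ExteriorAlgebra.ιMulti ℚ k (fun j => b (leftExp d j)) *
          (contract (wedgeBeta k n)).unop (u : ExteriorAlgebra ℚ V)) := by
    intro n
    have h2 := sum_coeff_alternant ((detLinear r (hForm r) ∘ₗ LinearMap.mulRight ℚ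
      ((contract (wedgeBeta k n)).unop (u : ExteriorAlgebra ℚ V))).compAlternatingMap
        (ExteriorAlgebra.ιMulti ℚ k)) b (leftExp d) (partsLE k d.degree)
        fun m hm => mem_partsLE_of_sum_le (by omega)
    simp only [LinearMap.compAlternatingMap_apply, LinearMap.comp_apply,
      LinearMap.mulRight_apply] at h2
    rw [← h2, Finset.smul_sum]
    refine Finset.sum_congr rfl fun m _ => ?_
    rw [action_boson, mul_comm, mul_smul]
    rfl
  rw [Finset.sum_congr rfl fun n _ => h1 n]
  have h2 := sum_coeff_alternant ((detLinear r (hForm r) ∘ₗ LinearMap.mulLeft ℚ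
      (ExteriorAlgebra.ιMulti ℚ k (fun j => b (leftExp d j))) ∘ₗ
      (LinearMap.applyₗ (u : ExteriorAlgebra ℚ V)) ∘ₗ
      (MulOpposite.opLinearEquiv ℚ).symm.toLinearMap ∘ₗ contract.toLinearMap).compAlternatingMap
        (ExteriorAlgebra.ιMulti ℚ k)) beta (rightExp d) (partsLE k d.degree)
        fun m hm => mem_partsLE_of_sum_le (by omega)
  exact h2

/-! ### Power series in one of the variables -/

/-- The index of the variable `z_c`, as an embedding of a one-point type. -/
def inlEmb {k : ℕ} (c : Fin k) : Unit ↪ Fin k ⊕ Fin k :=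
  ⟨fun _ => Sum.inl c, fun _ _ _ => rfl⟩

/-- The substitution of the variable `z_c` in a power series in one variable. -/
def inVar (r : ℕ) {k : ℕ} (c : Fin k) :
    PowerSeries (B r) →ₐ[B r] MvPowerSeries (Fin k ⊕ Fin k) (B r) :=
  MvPowerSeries.rename (inlEmb c)

theorem coeff_single_inVar {r k : ℕ} (c : Fin k) (n : ℕ) (p : PowerSeries (B r)) :
    MvPowerSeries.coeff (Finsupp.single (Sum.inl c) n) (inVar r c p) = PowerSeries.coeff n p := by
  have := MvPowerSeries.coeff_embDomain_rename (inlEmb c) p (Finsupp.single () n)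
  rwa [Finsupp.embDomain_single] at this

theorem coeff_inVar_eq_zero {r k : ℕ} (c : Fin k) (p : PowerSeries (B r))
    {d : Fin k ⊕ Fin k →₀ ℕ} (hd : d ≠ Finsupp.single (Sum.inl c) (d (Sum.inl c))) :
    MvPowerSeries.coeff d (inVar r c p) = 0 := by
  apply MvPowerSeries.coeff_rename_eq_zero
  rintro ⟨x, rfl⟩
  apply hd
  have hx : x = Finsupp.single () (x ()) := by
    ext
    simp
  rw [hx, Finsupp.mapDomain_single]
  exact congrArg _ Finsupp.single_eq_same.symm

theorem coeff_prod_inVar {r k : ℕ} (p : Fin k → PowerSeries (B r)) (d : Fin k ⊕ Fin k →₀ ℕ) :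
    MvPowerSeries.coeff d (∏ c, inVar r c (p c)) =
      if rightExp d = 0 then ∏ c, PowerSeries.coeff (leftExp d c) (p c) else 0 := by
  classical
  -- Each factor involves one variable, so only one splitting of `d` among the factors can
  -- contribute.
  have h1 : ∀ l ∈ Finset.finsuppAntidiag Finset.univ d,
      ∏ c : Fin k, MvPowerSeries.coeff (l c) (inVar r c (p c)) ≠ 0 →
      ∀ c, l c = Finsupp.single (Sum.inl c) (d (Sum.inl c)) := by
    intro l hl h0
    have h2 : ∀ c, l c = Finsupp.single (Sum.inl c) (l c (Sum.inl c)) := by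
      intro c
      by_contra h3
      exact Finset.prod_ne_zero_iff.1 h0 c (Finset.mem_univ c) (coeff_inVar_eq_zero c _ h3)
    intro c
    have h3 : (∑ c', l c') (Sum.inl c) = d (Sum.inl c) := by
      rw [(Finset.mem_finsuppAntidiag.1 hl).1]
    rw [Finsupp.finsetSum_apply, Finset.sum_eq_single c] at h3
    · rw [← h3]
      exact h2 c
    · intro c' _ hc'
      rw [h2 c', Finsupp.single_eq_of_ne (by simpa using hc'.symm)]
    · simp
  rw [MvPowerSeries.coeff_prod]
  split_ifs with hd
  · rw [Finset.sum_eq_single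
      (Finsupp.equivFunOnFinite.symm fun c => Finsupp.single (Sum.inl c) (d (Sum.inl c)))]
    · simp [coeff_single_inVar]
    · intro l hl hne
      by_contra h0
      exact hne (Finsupp.ext fun c => h1 l hl h0 c)
    · intro hl
      exfalso
      apply hl
      rw [Finset.mem_finsuppAntidiag]
      refine ⟨?_, Finset.subset_univ _⟩
      ext (c | c)
      · rw [Finsupp.finsetSum_apply, Finset.sum_eq_single c]
        · simp
        · intro c' _ hc'
          simp [hc']
        · simp
      · rw [Finsupp.finsetSum_apply, Finset.sum_eq_zero]
        · exact (DFunLike.congr_fun hd c).symm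
        · simp
  · refine Finset.sum_eq_zero fun l hl => ?_
    by_contra h0
    apply hd
    ext c
    have h3 := (Finset.mem_finsuppAntidiag.1 hl).1
    rw [rightExp_apply, ← h3, Finsupp.finsetSum_apply, Finset.sum_eq_zero]
    · rfl
    · intro c' _
      rw [h1 l hl h0 c']
      simp

/-- The series `∑_m h_{m-r+1+a} z_c^m = z_c^{r-1-a} / E_r(z_c)`. -/
def columnSeries (r : ℕ) {k : ℕ} (c : Fin k) (a : ℕ) : MvPowerSeries (Fin k ⊕ Fin k) (B r) :=
  inVar r c (PowerSeries.X ^ (r - 1 - a) * PowerSeries.invOfUnit (E r) 1)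

theorem columnSeries_mul (r : ℕ) {k : ℕ} (c : Fin k) (a : ℕ) :
    columnSeries r c a * inVar r c (E r : PowerSeries (B r)) =
      MvPowerSeries.X (Sum.inl c) ^ (r - 1 - a) := by
  rw [columnSeries, ← map_mul, mul_assoc, mul_comm (PowerSeries.invOfUnit _ _), E_mul_inv, mul_one,
    map_pow]
  congr 1
  exact MvPowerSeries.rename_X _ ()

theorem coeff_pow_mul_inv (r : ℕ) (a : Fin r) (m : ℕ) :
    PowerSeries.coeff m (PowerSeries.X ^ (r - 1 - a) * PowerSeries.invOfUnit (E r) 1) =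
      hForm r a (b m) := by
  have ha := a.2
  rw [hForm_b, PowerSeries.coeff_X_pow_mul', h]
  by_cases hm : r - 1 - a ≤ m
  · rw [if_pos hm, if_pos (by omega)]
    congr 2
    omega
  · rw [if_neg hm, if_neg (by omega)]

/-! ### The generating series of wedge products -/

/-- The series `∑_m z^m Δ(b_{m_1} ∧ ⋯ ∧ b_{m_k} ∧ ω)`. -/
def wedgeSeries (r k : ℕ) :
    ExteriorAlgebra ℚ V →ₗ[ℚ] MvPowerSeries (Fin k ⊕ Fin k) (B r) :=
  LinearMap.pi fun d => if rightExp d = 0 then detLinear r (hForm r) ∘ₗ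
    LinearMap.mulLeft ℚ (ExteriorAlgebra.ιMulti ℚ k fun j => b (leftExp d j)) else 0

theorem coeff_wedgeSeries (r k : ℕ) (o : ExteriorAlgebra ℚ V) (d : Fin k ⊕ Fin k →₀ ℕ) :
    MvPowerSeries.coeff d (wedgeSeries r k o) = if rightExp d = 0 then
      detLinear r (hForm r) (ExteriorAlgebra.ιMulti ℚ k (fun j => b (leftExp d j)) * o) else 0 := by
  change (if rightExp d = 0 then detLinear r (hForm r) ∘ₗ
    LinearMap.mulLeft ℚ (ExteriorAlgebra.ιMulti ℚ k fun j => b (leftExp d j)) else 0) o = _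
  split_ifs <;> rfl

/-- The determinant is linear in each column, and each `z_c` occurs in one column only, so the sum
over the exponents can be taken inside the columns. The check is made coefficientwise on the
permutation expansion. -/
theorem wedgeSeries_ιMulti (k q : ℕ) (v : Fin q → V) :
    wedgeSeries (k + q) k (ExteriorAlgebra.ιMulti ℚ q v) =
      Matrix.det (Matrix.of fun i j : Fin (k + q) =>
        (Fin.append (fun c : Fin k => columnSeries (k + q) c i)
          (fun t => MvPowerSeries.C (hForm (k + q) i (v t))) j :
            MvPowerSeries (Fin k ⊕ Fin k) (B (k + q)))) := by
  ext1 d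
  rw [coeff_wedgeSeries, ExteriorAlgebra.ιMulti_mul_ιMulti, detLinear_ιMulti, Matrix.det_apply,
    Matrix.det_apply, map_sum]
  have h1 : ∀ s : Equiv.Perm (Fin (k + q)), MvPowerSeries.coeff d (Equiv.Perm.sign s •
      ∏ j, (Matrix.of fun i j : Fin (k + q) =>
        (Fin.append (fun c : Fin k => columnSeries (k + q) c i)
          (fun t => MvPowerSeries.C (hForm (k + q) i (v t))) j :
            MvPowerSeries (Fin k ⊕ Fin k) (B (k + q)))) (s j) j) =
      if rightExp d = 0 then Equiv.Perm.sign s • ∏ j, (Matrix.of fun i j : Fin (k + q) =>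
        hForm (k + q) i (Fin.append (fun j => b (leftExp d j)) v j)) (s j) j else 0 := by
    intro s
    simp only [Matrix.of_apply, Fin.prod_univ_add, Fin.append_left, Fin.append_right]
    rw [Units.smul_def, map_zsmul, ← map_prod, mul_comm, MvPowerSeries.coeff_C_mul]
    simp only [columnSeries]
    rw [coeff_prod_inVar]
    simp only [coeff_pow_mul_inv]
    split_ifs
    · rw [mul_comm, Units.smul_def]
    · rw [mul_zero, smul_zero]
  simp only [h1]
  split_ifs
  · rfl
  · rw [Finset.sum_const_zero]

theorem contract_ιMulti_eq_zero (k n : ℕ) (d : Fin k → Module.Dual ℚ V) (v : Fin n → V)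
    (i : Fin k) (hi : ∀ j, d i (v j) = 0) :
    (contract (ExteriorAlgebra.ιMulti ℚ k d)).unop (ExteriorAlgebra.ιMulti ℚ n v) = 0 := by
  induction k generalizing n with
  | zero => exact i.elim0
  | succ k ih =>
    rw [ExteriorAlgebra.ιMulti_succ_apply, contract_ι_mul]
    cases n with
    | zero =>
      rw [contractLeft_zero_degree _ _ (ExteriorAlgebra.ιMulti_range ℚ 0 (Set.mem_range_self v)),
        map_zero]
    | succ n =>
      rw [contractLeft_ιMulti, map_sum]
      refine Finset.sum_eq_zero fun l _ => ?_
      rw [map_smul]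
      induction i using Fin.cases with
      | zero => rw [hi, mul_zero, zero_smul]
      | succ i => rw [ih n (Matrix.vecTail d) _ i fun j => hi _, smul_zero]

/-- The exponent vector of the monomial `∏ w_j^{-n_j}`. -/
def inrExp {k : ℕ} (n : Fin k → ℕ) : Fin k ⊕ Fin k →₀ ℕ :=
  Finsupp.equivFunOnFinite.symm (Sum.elim 0 n)

/-- Contraction with `β_{n_c}` kills the wedge product unless `n_c` is one of the `m_j`, so the
dependence on `w` is polynomial and the sum over `n` is finite. -/
theorem vandermondes_mul_generating (r k : ℕ) (m : Fin r → ℕ) :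
    toSeries r (vandermondes k) *
        generating r k (boson r (exteriorPower.ιMulti ℚ r fun j => b (m j))) =
      ∑ n ∈ Fintype.piFinset fun _ : Fin k => Finset.univ.image m,
        MvPowerSeries.monomial (inrExp n) 1 * wedgeSeries r k
          ((contract (ExteriorAlgebra.ιMulti ℚ k fun j => beta (n j))).unop
            (ExteriorAlgebra.ιMulti ℚ r fun j => b (m j))) := by
  ext1 d
  rw [coeff_vandermondes_mul_generating, exteriorPower.ιMulti_apply_coe, map_sum]
  simp only [MvPowerSeries.coeff_monomial_mul, coeff_wedgeSeries, one_mul]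
  have h1 : ∀ n : Fin k → ℕ, inrExp n ≤ d → rightExp (d - inrExp n) = 0 → n = rightExp d := by
    intro n h2 h3
    ext j
    have h4 : n j ≤ d (Sum.inr j) := h2 (Sum.inr j)
    have h5 : d (Sum.inr j) - n j = 0 := DFunLike.congr_fun h3 j
    rw [rightExp_apply]
    omega
  have h2 : inrExp (rightExp d) ≤ d := by
    intro j
    rcases j with j | j
    · exact Nat.zero_le _
    · exact le_rfl
  have h3 : rightExp (d - inrExp (rightExp d)) = 0 := by
    ext j
    exact Nat.sub_self (d (Sum.inr j))
  have h4 : leftExp (d - inrExp (rightExp d)) = leftExp d := by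
    ext j
    exact Nat.sub_zero (d (Sum.inl j))
  rw [Finset.sum_eq_single (⇑(rightExp d))]
  · rw [if_pos h2, if_pos h3, h4]
  · intro n _ hn
    split_ifs with h5 h6
    · exact absurd (h1 n h5 h6) hn
    · rfl
    · rfl
  · intro hd
    rw [if_pos h2, if_pos h3]
    obtain ⟨i, hi⟩ : ∃ i, ∀ j, m j ≠ rightExp d i := by
      simpa [Fintype.mem_piFinset] using hd
    rw [contract_ιMulti_eq_zero k r _ _ i, mul_zero, map_zero]
    intro j
    rw [beta, b, Finsupp.lapply_apply, Finsupp.single_eq_of_ne (hi j).symm]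

/-! ### Determinants over a field -/

section Field

variable {F : Type*} [Field F]

theorem det_pow_sub_eq_prod (k : ℕ) (x : Fin k → F) :
    Matrix.det (Matrix.of fun i j : Fin k => x i ^ (k - 1 - (j : ℕ))) =
      ∏ i, ∏ j ∈ Finset.Ioi i, (x i - x j) := by
  have h1 : (Matrix.of fun i j : Fin k => x i ^ (k - 1 - (j : ℕ))) =
      Matrix.projVandermonde (fun _ => 1) x := by
    ext i j
    rw [Matrix.projVandermonde_apply, one_pow, one_mul, Matrix.of_apply, Fin.val_rev]
    congr 1
    omega
  rw [h1, Matrix.det_projVandermonde]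
  simp

theorem det_pow_sub_ne_zero (k : ℕ) (x : Fin k → F) (hx : Function.Injective x) :
    Matrix.det (Matrix.of fun i j : Fin k => x i ^ (k - 1 - (j : ℕ))) ≠ 0 := by
  rw [det_pow_sub_eq_prod]
  refine Finset.prod_ne_zero_iff.2 fun i _ => Finset.prod_ne_zero_iff.2 fun j hj => ?_
  exact sub_ne_zero.2 (hx.ne (Finset.mem_Ioi.1 hj).ne)

theorem sum_le_linearProd {k n : ℕ} (y : Fin k → F) (f : ℕ → F) (a : ℕ) (ha : k ≤ a) (han : a < n) :
    ∑ c : Fin n, (if (c : ℕ) ≤ a then (linearProd y).coeff (a - c) else 0) * f c =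
      ∑ s ∈ Finset.range (k + 1), (linearProd y).coeff s * f (a - s) := by
  rw [Fin.sum_univ_eq_sum_range
    (fun c => (if c ≤ a then (linearProd y).coeff (a - c) else 0) * f c) n,
    ← Finset.sum_subset (Finset.range_subset_range.2 (Nat.succ_le_of_lt han)),
    ← Finset.sum_range_reflect]
  · rw [← Finset.sum_subset (Finset.range_subset_range.2 (Nat.succ_le_succ ha))]
    · refine Finset.sum_congr rfl fun s hs => ?_
      have hs' := Finset.mem_range.1 hs
      rw [if_pos (by omega)]
      congr 2
      omega
    · intro s hs hs'
      rw [Finset.mem_range] at hs hs'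
      rw [if_pos (by omega), linearProd_coeff_of_lt _ (by omega), zero_mul]
  · intro s _ hs
    rw [Finset.mem_range] at hs
    rw [if_neg (by omega), zero_mul]

/-- Elimination in a matrix whose first `k` columns are geometric progressions. -/
theorem det_append_geometric (k q : ℕ) (x g : Fin k → F) (hx : ∀ c, x c ≠ 0) (A : ℕ → Fin q → F) :
    Matrix.det (Matrix.of fun i j : Fin (k + q) =>
      (Fin.append (fun c : Fin k => x c ^ (k + q - 1 - i) * g c) (fun t => A i t) j : F)) =
    (∏ c, x c ^ q * g c) * Matrix.det (Matrix.of fun i j : Fin k => x i ^ (k - 1 - (j : ℕ))) *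
      Matrix.det (Matrix.of fun i t : Fin q => ∑ s ∈ Finset.range (k + 1),
        (linearProd fun c => (x c)⁻¹).coeff s * A (k + i - s) t) := by
  set y : Fin k → F := fun c => (x c)⁻¹ with hy
  set M : Matrix (Fin (k + q)) (Fin (k + q)) F := Matrix.of fun i j : Fin (k + q) =>
      (Fin.append (fun c : Fin k => x c ^ (k + q - 1 - i) * g c) (fun t => A i t) j : F) with hM
  -- Left multiplication by `T` keeps the first `k` rows and applies the recurrence to row `i ≥ k`,
  -- which involves only rows `i - k, …, i`.
  set T : Matrix (Fin (k + q)) (Fin (k + q)) F := Matrix.of fun i j : Fin (k + q) =>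
    if (i : ℕ) < k then (if i = j then 1 else 0)
    else if (j : ℕ) ≤ i then (linearProd y).coeff (i - j) else 0 with hT
  have hdet : T.det = 1 := by
    rw [Matrix.det_of_isLowerTriangular]
    · refine Finset.prod_eq_one fun i _ => ?_
      simp [hT, linearProd_coeff_zero]
    · intro i j hij
      have hij : i < j := hij
      simp [hT, hij.ne, hij.not_ge]
  have hblock : (T * M).submatrix finSumFinEquiv finSumFinEquiv = Matrix.fromBlocks
      (Matrix.of fun i j : Fin k => (x j ^ q * g j) * x j ^ (k - 1 - (i : ℕ)))
      (Matrix.of fun (i : Fin k) (t : Fin q) => A i t) 0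
      (Matrix.of fun i t : Fin q => ∑ s ∈ Finset.range (k + 1),
        (linearProd y).coeff s * A (k + i - s) t) := by
    have htop : ∀ (i : Fin k) j, (T * M) (Fin.castAdd q i) j = M (Fin.castAdd q i) j := by
      intro i j
      simp [Matrix.mul_apply, hT]
    have hbot : ∀ (i : Fin q) (j : Fin (k + q)) (f : ℕ → F) (_ : ∀ c : Fin (k + q), M c j = f c),
        (T * M) (Fin.natAdd k i) j =
          ∑ s ∈ Finset.range (k + 1), (linearProd y).coeff s * f (k + i - s) := by
      intro i j f hf
      rw [← sum_le_linearProd (n := k + q) y f (k + i) (Nat.le_add_right _ _)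
        (Nat.add_lt_add_left i.2 k), Matrix.mul_apply]
      simp [hT, hf]
      rfl
    ext i j
    rcases i with i | i <;> rcases j with j | j
    · simp only [Matrix.submatrix_apply, finSumFinEquiv_apply_left, Matrix.fromBlocks_apply₁₁]
      rw [htop]
      simp only [hM, Matrix.of_apply, Fin.append_left, Fin.val_castAdd]
      have := i.2
      rw [mul_right_comm, ← pow_add]
      congr 2
      omega
    · simp only [Matrix.submatrix_apply, finSumFinEquiv_apply_left, finSumFinEquiv_apply_right,
        Matrix.fromBlocks_apply₁₂]
      rw [htop]
      simp [hM]
    · simp only [Matrix.submatrix_apply, finSumFinEquiv_apply_left, finSumFinEquiv_apply_right,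
        Matrix.fromBlocks_apply₂₁]
      rw [hbot i _ (fun a => x j ^ (k + q - 1 - a) * g j) fun c => by simp [hM]]
      have h1 := linearProd_sum_coeff x hx j
      have hi := i.2
      calc _ = ∑ s ∈ Finset.range (k + 1), (linearProd y).coeff s * x j ^ s *
            (x j ^ (q - 1 - i) * g j) := by
            refine Finset.sum_congr rfl fun s hs => ?_
            have hs' := Finset.mem_range.1 hs
            -- The factor `x_j^{q-1-i}` does not depend on `s`; what remains is the polynomial
            -- evaluated at its root `x_j`.
            have h2 : k + q - 1 - (k + i - s) = s + (q - 1 - i) := by omega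
            rw [h2, pow_add]
            ring
        _ = 0 := by rw [← Finset.sum_mul, h1, zero_mul]
    · simp only [Matrix.submatrix_apply, finSumFinEquiv_apply_right, Matrix.fromBlocks_apply₂₂]
      rw [hbot i _ (fun a => A a j) fun c => by simp [hM]]
      rfl
  have h1 : M.det = (T * M).det := by rw [Matrix.det_mul, hdet, one_mul]
  rw [h1, ← Matrix.det_submatrix_equiv_self finSumFinEquiv (T * M), hblock,
    Matrix.det_fromBlocks_zero₂₁]
  congr 1
  have h2 := Matrix.det_mul_row (fun j => x j ^ q * g j)
    (Matrix.of fun i j : Fin k => x j ^ (k - 1 - (i : ℕ)))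
  simp only [Matrix.of_apply] at h2
  rw [h2, ← Matrix.det_transpose]
  rfl

/-- Expansion of the first `k` rows of a determinant into rows of zeros and ones. -/
theorem sum_det_append (k q : ℕ) (y : Fin k → F) (m : Fin (k + q) → ℕ)
    (A : Fin q → Fin (k + q) → F) :
    ∑ n ∈ Fintype.piFinset fun _ : Fin k => Finset.univ.image m, (∏ c, y c ^ n c) *
      Matrix.det (Matrix.of fun i j : Fin (k + q) =>
        (Fin.append (fun c => if n c = m j then 1 else 0) (fun t => A t j) i : F)) =
      Matrix.det (Matrix.of fun i j : Fin (k + q) =>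
        (Fin.append (fun c => y c ^ m j) (fun t => A t j) i : F)) := by
  simp only [← Matrix.det_transpose (Matrix.of _), Matrix.det_apply, Finset.mul_sum,
    Matrix.transpose_apply, Matrix.of_apply, Fin.prod_univ_add, Fin.append_left, Fin.append_right]
  rw [Finset.sum_comm]
  refine Finset.sum_congr rfl fun s _ => ?_
  -- Each power is written as a sum over all possible exponents with a Kronecker delta; the product
  -- of these sums is then expanded.
  have h1 : ∏ c : Fin k, y c ^ m (s (Fin.castAdd q c)) =
      ∏ c : Fin k, ∑ n ∈ Finset.univ.image m,
        y c ^ n * (if n = m (s (Fin.castAdd q c)) then 1 else 0) := by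
    refine Finset.prod_congr rfl fun c _ => ?_
    simp
  rw [h1, Finset.prod_univ_sum, Finset.sum_mul, Finset.smul_sum]
  refine Finset.sum_congr rfl fun n _ => ?_
  rw [mul_smul_comm, Finset.prod_mul_distrib, mul_assoc]

end Field

/-! ### The formal variables in the fraction field -/

theorem algebraMap_inVar (r k : ℕ) (c : Fin k) (p : Polynomial (B r)) :
    algebraMap (MvPowerSeries (Fin k ⊕ Fin k) (B r)) (K r k) (inVar r c (p : PowerSeries (B r))) =
      Polynomial.aeval (z r k c) p := by
  have h1 : (inVar r c).comp (Polynomial.coeToPowerSeries.algHom (B r)) =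
      Polynomial.aeval (MvPowerSeries.X (Sum.inl c)) := by
    apply Polynomial.algHom_ext
    rw [Polynomial.aeval_X, AlgHom.comp_apply, Polynomial.coeToPowerSeries.algHom_apply]
    simp only [Polynomial.coe_X, Algebra.algebraMap_self, PowerSeries.map_id]
    exact MvPowerSeries.rename_X _ ()
  have h2 := DFunLike.congr_fun h1 p
  simp only [AlgHom.comp_apply, Polynomial.coeToPowerSeries.algHom_apply, Algebra.algebraMap_self,
    PowerSeries.map_id] at h2
  rw [z, Polynomial.aeval_algebraMap_apply, ← h2]
  rfl

/-- As a power series `E_r` is invertible, so its image in the field is nonzero. -/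
theorem aeval_E_ne_zero (r k : ℕ) (c : Fin k) : Polynomial.aeval (z r k c) (E r) ≠ 0 := by
  rw [← algebraMap_inVar]
  have h1 := congrArg (inVar r c) (E_mul_inv r)
  have h2 := congrArg (algebraMap (MvPowerSeries (Fin k ⊕ Fin k) (B r)) (K r k)) h1
  rw [map_mul, map_mul, map_one, map_one] at h2
  exact left_ne_zero_of_mul (h2.trans_ne one_ne_zero)

theorem algebraMap_columnSeries (r k : ℕ) (c : Fin k) (a : ℕ) :
    algebraMap (MvPowerSeries (Fin k ⊕ Fin k) (B r)) (K r k) (columnSeries r c a) =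
      z r k c ^ (r - 1 - a) * (1 / Polynomial.aeval (z r k c) (E r)) := by
  have h1 := congrArg (algebraMap (MvPowerSeries (Fin k ⊕ Fin k) (B r)) (K r k))
    (columnSeries_mul r c a)
  rw [map_mul, algebraMap_inVar, map_pow] at h1
  rw [mul_one_div, eq_div_iff (aeval_E_ne_zero r k c)]
  exact h1

theorem X_injective (r : ℕ) {σ : Type*} :
    Function.Injective (MvPowerSeries.X : σ → MvPowerSeries σ (B r)) := fun _ _ hst =>
  MvPowerSeries.X_inj.1 hst

theorem z_injective (r k : ℕ) : Function.Injective (z r k) := fun i j hij => by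
  have h1 := IsFractionRing.injective (MvPowerSeries (Fin k ⊕ Fin k) (B r)) (K r k) hij
  exact Sum.inl_injective (X_injective r h1)

theorem inv_w (r k : ℕ) (j : Fin k) : (w r k j)⁻¹ =
    algebraMap (MvPowerSeries (Fin k ⊕ Fin k) (B r)) (K r k) (MvPowerSeries.X (Sum.inr j)) :=
  inv_inv _

theorem inv_w_injective (r k : ℕ) : Function.Injective fun j => (w r k j)⁻¹ := fun i j hij => by
  simp only [inv_w] at hij
  have h1 := IsFractionRing.injective (MvPowerSeries (Fin k ⊕ Fin k) (B r)) (K r k) hij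
  exact Sum.inr_injective (X_injective r h1)

theorem X_ne_zero' (r k : ℕ) (s : Fin k ⊕ Fin k) :
    algebraMap (MvPowerSeries (Fin k ⊕ Fin k) (B r)) (K r k) (MvPowerSeries.X s) ≠ 0 := by
  rw [Ne, IsFractionRing.to_map_eq_zero_iff]
  intro h0
  have := congrArg (MvPowerSeries.coeff (Finsupp.single s 1)) h0
  simp at this

theorem algebraMap_toSeries (r k : ℕ) (p : MvPolynomial (Fin k ⊕ Fin k) ℚ) :
    algebraMap (MvPowerSeries (Fin k ⊕ Fin k) (B r)) (K r k) (toSeries r p) =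
      MvPolynomial.aeval (Sum.elim (z r k) fun j => (w r k j)⁻¹) p := by
  have h1 : (algebraMap (MvPowerSeries (Fin k ⊕ Fin k) (B r)) (K r k)).comp
      (MvPolynomial.coeToMvPowerSeries.ringHom.comp (MvPolynomial.map (algebraMap ℚ (B r)))) =
      (MvPolynomial.aeval (R := ℚ) (Sum.elim (z r k) fun j => (w r k j)⁻¹)).toRingHom := by
    apply MvPolynomial.ringHom_ext
    · intro c
      exact RingHom.congr_fun (Subsingleton.elim (((algebraMap (MvPowerSeries (Fin k ⊕ Fin k) (B r))
        (K r k)).comp (MvPolynomial.coeToMvPowerSeries.ringHom.comp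
          (MvPolynomial.map (algebraMap ℚ (B r))))).comp MvPolynomial.C)
        ((MvPolynomial.aeval (R := ℚ) (Sum.elim (z r k) fun j => (w r k j)⁻¹)).toRingHom.comp
          MvPolynomial.C)) c
    · rintro (j | j)
      · simp [z]
      · simp [inv_w]
  exact RingHom.congr_fun h1 p

theorem algebraMap_vandermondes (r k : ℕ) :
    algebraMap (MvPowerSeries (Fin k ⊕ Fin k) (B r)) (K r k) (toSeries r (vandermondes k)) =
      Matrix.det (Matrix.of fun i j : Fin k => z r k i ^ (k - 1 - (j : ℕ))) *
      Matrix.det (Matrix.of fun i j : Fin k => (w r k i)⁻¹ ^ (k - 1 - (j : ℕ))) := by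
  have h1 := vandermondes_mul_schur k (zeroPart k) (zeroPart k)
  have h2 : schur k (zeroPart k) = 1 := by
    have := schur_mul_alternating k (zeroPart k)
    exact mul_right_cancel₀ (alternating_zero_ne_zero k) (by rw [← this, one_mul])
  rw [h2, map_one, map_one, mul_one, mul_one] at h1
  rw [algebraMap_toSeries, h1, map_mul, MvPolynomial.aeval_rename, MvPolynomial.aeval_rename,
    alternant, AlgHom.map_det, AlgHom.map_det]
  congr 2 <;>
  · ext i j
    simp [exponents, zeroPart]

/-! ### The generating function in the fraction field -/

/-- The linear form `b_m ↦ σ̄_-(z) h_{m-r+1+k+i}` for `r = k + q`. -/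
def sigmaForm (k q : ℕ) (i : ℕ) : V →ₗ[ℚ] K (k + q) k :=
  ∑ s ∈ Finset.range (k + 1), (linearProd fun a => (z (k + q) k a)⁻¹).coeff s •
    ((Algebra.linearMap (B (k + q)) (K (k + q) k)).restrictScalars ℚ ∘ₗ
      hForm (k + q) (k + i - s))

theorem sigmaForm_apply (k q i : ℕ) (v : V) : sigmaForm k q i v =
    ∑ s ∈ Finset.range (k + 1), (linearProd fun a => (z (k + q) k a)⁻¹).coeff s *
      algebraMap (B (k + q)) (K (k + q) k) (hForm (k + q) (k + i - s) v) := by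
  simp [sigmaForm]

theorem sigmaForm_b (k q i m : ℕ) : sigmaForm k q i (b m) =
    sigmaBarMulti (k + q) k (h (k + q) ((m : ℤ) - (k + q : ℕ) + 1 + (k + i : ℕ))) := by
  rw [sigmaForm_apply, sigmaBarMulti_h _ _ (Nat.le_add_right k q)]
  refine Finset.sum_congr rfl fun s hs => ?_
  have hs' := Finset.mem_range.1 hs
  rw [hForm_b]
  congr 3
  omega

/-- Elimination handles wedge products of vectors; linearity extends it to all of `⋀^q V`, as needed
for contractions. -/
theorem algebraMap_wedgeSeries (k q : ℕ) (o : ExteriorAlgebra ℚ V) (ho : o ∈ ⋀[ℚ]^q V) :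
    algebraMap (MvPowerSeries (Fin k ⊕ Fin k) (B (k + q))) (K (k + q) k)
        (wedgeSeries (k + q) k o) =
      (∏ c, z (k + q) k c ^ q * (1 / Polynomial.aeval (z (k + q) k c) (E (k + q)))) *
        Matrix.det (Matrix.of fun i j : Fin k => z (k + q) k i ^ (k - 1 - (j : ℕ))) *
        detLinear q (sigmaForm k q) o := by
  rw [← ExteriorAlgebra.ιMulti_span_fixedDegree] at ho
  induction ho using Submodule.span_induction with
  | mem x hx =>
    obtain ⟨v, rfl⟩ := hx
    rw [wedgeSeries_ιMulti, RingHom.map_det, detLinear_ιMulti]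
    simp only [sigmaForm_apply]
    rw [← det_append_geometric k q (z (k + q) k) _ (fun c => X_ne_zero' _ _ _)
      (fun i t => algebraMap (B (k + q)) (K (k + q) k) (hForm (k + q) i (v t)))]
    refine congrArg Matrix.det (Matrix.ext fun i j => ?_)
    rw [RingHom.mapMatrix_apply, Matrix.map_apply, Matrix.of_apply, Matrix.of_apply]
    refine Fin.addCases (fun c => ?_) (fun t => ?_) j
    · rw [Fin.append_left, Fin.append_left, algebraMap_columnSeries]
    · rw [Fin.append_right, Fin.append_right,
        IsScalarTower.algebraMap_apply (B (k + q)) (MvPowerSeries (Fin k ⊕ Fin k) (B (k + q)))]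
      rfl
  | zero => simp only [map_zero, mul_zero]
  | add x y _ _ hx hy => rw [map_add, map_add, map_add, hx, hy, mul_add]
  | smul c x _ hx => rw [map_smul (wedgeSeries _ _), map_smul (detLinear _ _), map_rat_smul, hx, mul_smul_comm]

theorem algebraMap_monomial_inrExp (r k : ℕ) (n : Fin k → ℕ) :
    algebraMap (MvPowerSeries (Fin k ⊕ Fin k) (B r)) (K r k)
      (MvPowerSeries.monomial (inrExp n) 1) = ∏ c, (w r k c)⁻¹ ^ n c := by
  have h1 : MvPowerSeries.monomial (inrExp n) (1 : B r) =
      toSeries r (MvPolynomial.monomial (inrExp n) 1) := by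
    simp [toSeries, MvPolynomial.map_monomial]
  rw [h1, algebraMap_toSeries, MvPolynomial.aeval_monomial, Finsupp.prod_fintype _ _ (by simp),
    Fintype.prod_sum_type]
  simp [inrExp]

theorem detLinear_sigmaForm_contract (k q : ℕ) (n : Fin k → ℕ) (m : Fin (k + q) → ℕ) :
    detLinear q (sigmaForm k q) ((contract (ExteriorAlgebra.ιMulti ℚ k fun j => beta (n j))).unop
      (ExteriorAlgebra.ιMulti ℚ (k + q) fun j => b (m j))) =
    Matrix.det (Matrix.of fun i j : Fin (k + q) => (Fin.append
      (fun c => if n c = m j then 1 else 0) (fun t => sigmaForm k q t (b (m j))) i : K (k + q) k)) := by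
  have h1 := detLinear_contract k q (k + q) rfl (fun j => beta (n j))
    -- The rows are the contracted forms `β_{n_i}`, followed by the forms with values `σ̄_-(z) h`.
    (fun i => if hi : i < k then Algebra.linearMap ℚ (K (k + q) k) ∘ₗ beta (n ⟨i, hi⟩)
      else sigmaForm k q (i - k)) (fun i x => by simp) (fun j => b (m j))
  simp only [Nat.not_lt.2 (Nat.le_add_right k _), dif_neg, not_false_eq_true,
    Nat.add_sub_cancel_left] at h1
  refine h1.trans (congrArg Matrix.det (Matrix.ext fun i j => ?_))
  rw [Matrix.of_apply, Matrix.of_apply]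
  refine Fin.addCases (fun c => ?_) (fun t => ?_) i
  · rw [Fin.append_left, dif_pos (by simp)]
    simp [beta, b, Finsupp.single_apply, eq_comm, apply_ite (algebraMap ℚ (K (k + q) k))]
  · rw [Fin.append_right, dif_neg (by simp)]
    simp

theorem algebraMap_vandermondes_mul_generating (k q : ℕ) (m : Fin (k + q) → ℕ) :
    algebraMap (MvPowerSeries (Fin k ⊕ Fin k) (B (k + q))) (K (k + q) k)
        (toSeries (k + q) (vandermondes k) * generating (k + q) k
          (boson (k + q) (exteriorPower.ιMulti ℚ (k + q) fun j => b (m j)))) =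
      (∏ c, z (k + q) k c ^ q * (1 / Polynomial.aeval (z (k + q) k c) (E (k + q)))) *
        Matrix.det (Matrix.of fun i j : Fin k => z (k + q) k i ^ (k - 1 - (j : ℕ))) *
        Matrix.det (Matrix.of fun i j : Fin (k + q) => (Fin.append
          (fun c => (w (k + q) k c)⁻¹ ^ m j) (fun t => sigmaForm k q t (b (m j))) i :
            K (k + q) k)) := by
  rw [vandermondes_mul_generating, map_sum, ← sum_det_append, Finset.mul_sum]
  refine Finset.sum_congr rfl fun n _ => ?_
  have h1 := (contract_mem k (fun j => beta (n j)) (k + q) _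
    (ExteriorAlgebra.ιMulti_range ℚ (k + q) (Set.mem_range_self fun j => b (m j)))).1
      (Nat.le_add_right k q)
  rw [Nat.add_sub_cancel_left] at h1
  rw [map_mul, algebraMap_monomial_inrExp, algebraMap_wedgeSeries k q _ h1,
    detLinear_sigmaForm_contract]
  ring

/-- With rows counted from zero, the factor `w_c^{-(r-1-c)}` removes the dependence of the exponent
on the row index, leaving `w_c^{-m_j}`. -/
theorem prod_mul_deformedDet (k q : ℕ) (l : Part (k + q)) :
    (∏ c : Fin k, (w (k + q) k c)⁻¹ ^ (k + q - 1 - (c : ℕ))) * deformedDet (k + q) k l =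
      Matrix.det (Matrix.of fun i j : Fin (k + q) => (Fin.append
        (fun c => (w (k + q) k c)⁻¹ ^ (k + q - 1 - j + l j))
        (fun t => sigmaForm k q t (b (k + q - 1 - j + l j))) i : K (k + q) k)) := by
  have h1 := Matrix.det_mul_column (Fin.append
    (fun c : Fin k => (w (k + q) k c)⁻¹ ^ (k + q - 1 - (c : ℕ))) (fun _ : Fin q => 1))
    (Matrix.of fun i j : Fin (k + q) =>
      if hi : (i : ℕ) < k then w (k + q) k ⟨i, hi⟩ ^ (-((l j : ℤ) - (j : ℕ) + (i : ℕ)))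
      else sigmaBarMulti (k + q) k (h (k + q) ((l j : ℤ) - (j : ℕ) + (i : ℕ))))
  rw [Fin.prod_univ_add] at h1
  simp only [Fin.append_left, Fin.append_right, Finset.prod_const_one, mul_one] at h1
  rw [deformedDet, ← h1]
  refine congrArg Matrix.det (Matrix.ext fun i j => ?_)
  simp only [Matrix.of_apply]
  have hj := j.2
  refine Fin.addCases (fun c => ?_) (fun t => ?_) i
  · have hc := c.2
    have hw : w (k + q) k c ≠ 0 := inv_ne_zero (X_ne_zero' _ _ _)
    rw [Fin.append_left, Fin.append_left, dif_pos (by simp), ← zpow_natCast, ← zpow_natCast,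
      inv_zpow', inv_zpow']
    simp only [Fin.val_castAdd]
    rw [← zpow_add₀ hw]
    congr 1
    omega
  · rw [Fin.append_right, Fin.append_right, dif_neg (by simp), one_mul, sigmaForm_b]
    congr 2
    simp only [Fin.val_natAdd]
    omega

/-- Use `w_i⁻¹ - w_j⁻¹ = w_i⁻¹ (1 - w_i / w_j)`; there are `k - 1 - i` indices `j > i`. -/
theorem prod_one_sub_div (r k : ℕ) :
    (∏ c : Fin k, (w r k c)⁻¹ ^ (k - 1 - (c : ℕ))) *
      ∏ i : Fin k, ∏ j ∈ Finset.Ioi i, (1 - w r k i / w r k j) =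
    Matrix.det (Matrix.of fun i j : Fin k => (w r k i)⁻¹ ^ (k - 1 - (j : ℕ))) := by
  rw [det_pow_sub_eq_prod k fun i => (w r k i)⁻¹, ← Finset.prod_mul_distrib]
  refine Finset.prod_congr rfl fun i _ => ?_
  rw [← Fin.card_Ioi, ← Finset.prod_const, ← Finset.prod_mul_distrib]
  refine Finset.prod_congr rfl fun j _ => ?_
  have hw : w r k i ≠ 0 := inv_ne_zero (X_ne_zero' _ _ _)
  rw [mul_sub, mul_one, mul_div_assoc', inv_mul_cancel₀ hw, one_div]

theorem algebraMap_generating_schurDet (k q : ℕ) (l : Part (k + q)) :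
    algebraMap (MvPowerSeries (Fin k ⊕ Fin k) (B (k + q))) (K (k + q) k)
        (generating (k + q) k (schurDet (k + q) l)) =
      (∏ j : Fin k, (z (k + q) k j / w (k + q) k j) ^ q *
          (1 / Polynomial.aeval (z (k + q) k j) (E (k + q)))) *
        (∏ i : Fin k, ∏ j ∈ Finset.Ioi i, (1 - w (k + q) k i / w (k + q) k j))⁻¹ *
        deformedDet (k + q) k l := by
  have h1 := algebraMap_vandermondes_mul_generating k q fun j => k + q - 1 - j + l j
  have h2 : boson (k + q) (exteriorPower.ιMulti ℚ (k + q) fun j => b (k + q - 1 - j + l j)) =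
      schurDet (k + q) l := toBoson_wedge (k + q) l
  have hz := det_pow_sub_ne_zero k _ (z_injective (k + q) k)
  have hw := det_pow_sub_ne_zero k _ (inv_w_injective (k + q) k)
  rw [h2, map_mul, algebraMap_vandermondes, ← prod_mul_deformedDet] at h1
  -- The part `w_c^{-(k-1-c)}` cancels against the Vandermonde determinant in `w⁻¹`; the part
  -- `w_c^{-q}` is the denominator of `(z_c / w_c)^q`.
  have h3 : ∏ c : Fin k, (w (k + q) k c)⁻¹ ^ (k + q - 1 - (c : ℕ)) =
      (∏ c : Fin k, (w (k + q) k c)⁻¹ ^ q) * ∏ c : Fin k, (w (k + q) k c)⁻¹ ^ (k - 1 - (c : ℕ)) := by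
    rw [← Finset.prod_mul_distrib]
    refine Finset.prod_congr rfl fun c _ => ?_
    rw [← pow_add]
    congr 1
    have := c.2
    omega
  have h4 := prod_one_sub_div (k + q) k
  have h5 : ∏ j : Fin k, (z (k + q) k j / w (k + q) k j) ^ q *
      (1 / Polynomial.aeval (z (k + q) k j) (E (k + q))) =
      (∏ c, z (k + q) k c ^ q * (1 / Polynomial.aeval (z (k + q) k c) (E (k + q)))) *
        ∏ c : Fin k, (w (k + q) k c)⁻¹ ^ q := by
    rw [← Finset.prod_mul_distrib]
    refine Finset.prod_congr rfl fun c _ => ?_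
    rw [div_eq_mul_inv (z (k + q) k c), mul_pow]
    ring
  rw [← h4] at h1 hw
  rw [h3] at h1
  rw [h5]
  have h6 := right_ne_zero_of_mul hw
  have h7 := left_ne_zero_of_mul hw
  generalize Matrix.det (Matrix.of fun i j : Fin k => z (k + q) k i ^ (k - 1 - (j : ℕ))) = dz at *
  generalize ∏ i : Fin k, ∏ j ∈ Finset.Ioi i, (1 - w (k + q) k i / w (k + q) k j) = dw at *
  generalize ∏ c : Fin k, (w (k + q) k c)⁻¹ ^ (k - 1 - (c : ℕ)) = p at *
  rw [mul_right_comm, ← div_eq_mul_inv, eq_div_iff h6]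
  apply mul_left_cancel₀ (mul_ne_zero hz h7)
  linear_combination h1

end

end BosonicRep

theorem mainTheorem2 (r k : ℕ) (hk : k ≤ r) (l : BosonicRep.Part r) :
    algebraMap (MvPowerSeries (Fin k ⊕ Fin k) (BosonicRep.B r)) (BosonicRep.K r k)
          (BosonicRep.generating r k (BosonicRep.schurDet r l)) =
        (∏ j : Fin k, (BosonicRep.z r k j / BosonicRep.w r k j) ^ (r - k) *
            (1 / Polynomial.aeval (BosonicRep.z r k j) (BosonicRep.E r))) *
          (∏ i : Fin k, ∏ j ∈ Finset.Ioi i, (1 - BosonicRep.w r k i / BosonicRep.w r k j))⁻¹ *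
          BosonicRep.deformedDet r k l ∧
      ∀ j : ℤ, BosonicRep.sigmaBarMulti r k (BosonicRep.h r j) =
        ∑ i ∈ Finset.range (k + 1),
          (-1) ^ i *
            MvPolynomial.aeval (fun a => (BosonicRep.z r k a)⁻¹) (MvPolynomial.esymm (Fin k) ℚ i) *
            algebraMap (BosonicRep.B r) (BosonicRep.K r k) (BosonicRep.h r (j - i)) := by
  refine ⟨?_, fun j => ?_⟩
  · obtain ⟨q, rfl⟩ := Nat.exists_eq_add_of_le hk
    rw [Nat.add_sub_cancel_left]
    exact BosonicRep.algebraMap_generating_schurDet k q l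
  · rw [BosonicRep.sigmaBarMulti_h r k hk]
    refine Finset.sum_congr rfl fun s hs => ?_
    rw [BosonicRep.linearProd_coeff _ (Nat.lt_succ_iff.1 (Finset.mem_range.1 hs))]
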